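/- Let $E\subset\mathbb R^d$ be the closure of a connected open set with smooth boundary, and let $\Theta$ be the set of configurations $\theta=\sum_i\delta_{x_i}$ on $E$ with finitely many points (counted with multiplicity) in every bounded set, equipped with the Borel $\sigma$-algebra of the vague topology. Let $K$ be a bounded non-negative definite operator on the complex space $L^2(E,dx)$ that has a continuous integral kernel $\mathsf K:E\times E\to\mathbb C$. Let $\mu$ be a determinantal random point field with kernel $\mathsf K$, that is, a probability measure on $\Theta$ whose correlation functions with respect to Lebesgue measure are $\rho_n(x_1,\dots,x_n)=\det(\mathsf K(x_i,x_j))_{1\le i,j\le n}$ for all $n$; this means that for disjoint bounded Borel sets $A_1,\dots,A_m\subset E$ and $k_1+\dots+k_m=n$, $$\int_{A_1^{k_1}\times\cdots\times A_m^{k_m}}\rho_n(x_1,\dots,x_n)\,dx_1\cdots dx_n=\int_\Theta\prod_{i=1}^m\frac{\theta(A_i)!}{(\theta(A_i)-k_i)!}\,d\mu ,$$ where a factor with $\theta(A_i)<k_i$ is $0$. A function $\mathfrak f:\Theta\to\mathbb R$ is local if for some $r$ it is $\sigma[\pi_r]$-measurable, where $\pi_r(\theta)=\theta(\cdot\cap(-r,r)^d)$,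 and smooth if $(x_1,\dots,x_n)\mapsto\mathfrak f(\eta+\delta_{x_1}+\dots+\delta_{x_n})$ is smooth on $E^n$ (up to the boundary) for all $n$ and all $\eta\in\Theta$. For local smooth $\mathfrak f,\mathfrak g$ and $\theta=\sum_i\delta_{x_i}$ put $$\mathbb D[\mathfrak f,\mathfrak g](\theta)=\frac12\sum_i\nabla_{x_i}\mathfrak f(\theta)\cdot\nabla_{x_i}\mathfrak g(\theta),\qquad \mathcal E(\mathfrak f,\mathfrak g)=\int_\Theta\mathbb D[\mathfrak f,\mathfrak g]\,d\mu ,$$ where $\nabla_{x_i}\mathfrak f(\theta)$ is the gradient of $\mathfrak f$ in the position of the $i$-th particle, and let $\mathcal D_\circ$ be the set of local smooth $\mathfrak f\in L^2(\Theta,\mu)$ with $\mathcal E(\mathfrak f,\mathfrak f)<\infty$. If $K$ is of trace class, then $(\mathcal E,\mathcal D_\circ)$ is closable on $L^2(\Theta,\mu)$: whenever $\mathfrak f_n\in\mathcal D_\circ$, $\mathfrak f_n\to0$ in $L^2(\Theta,\mu)$ and $\mathcal E(\mathfrak f_n-\mathfrak f_m,\mathfrak f_n-\mathfrak f_m)\to0$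 as $n,m\to\infty$, then $\mathcal E(\mathfrak f_n,\mathfrak f_n)\to0$. -/

import Mathlib

open MeasureTheory Filter Topology
open scoped ENNReal ContDiff

noncomputable section

namespace PointField

/-! ### Configuration spaces -/

/-- A configuration `θ = ∑ᵢ δ_{xᵢ}` on `S`, given by its multiplicities `x ↦ θ({x})`, with finitely
many particles (hence finite mass) in every bounded set. -/
@[ext]
structure Configuration (S : Type*) [PseudoMetricSpace S] where
  mult : S → ℕ
  locallyFinite : ∀ B : Set S, Bornology.IsBounded B → (B ∩ Function.support mult).Finite

namespace Configuration

variable {S : Type*} [PseudoMetricSpace S]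

/-- `θ(A)`, the number of particles in `A` counted with multiplicity. It is used only for bounded
sets `A`, where the sum is finite. -/
def count (θ : Configuration S) (A : Set S) : ℕ := ∑ᶠ x ∈ A, θ.mult x

/-- The restricted configuration `θ(· ∩ A)`. -/
def restrict (A : Set S) (θ : Configuration S) : Configuration S where
  mult := A.indicator θ.mult
  locallyFinite B hB := (θ.locallyFinite B hB).subset fun x hx =>
    ⟨hx.1, fun h => hx.2 (by by_cases hA : x ∈ A <;> simp [hA, h])⟩

/-- `η + δ_{x₁} + ⋯ + δ_{xₙ}`. -/
def addPoints (η : Configuration S) {n : ℕ} (x : Fin n → S) : Configuration S where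
  mult y := η.mult y + Nat.card {i // x i = y}
  locallyFinite B hB := ((η.locallyFinite B hB).union (Set.finite_range x)).subset fun y hy => by
    by_cases h : η.mult y = 0
    · right
      by_contra hr
      have : IsEmpty {i // x i = y} := ⟨fun i => hr ⟨i.1, i.2⟩⟩
      exact hy.2 (by simp [h])
    · exact Or.inl ⟨hy.1, h⟩

open scoped Classical in
/-- `θ - δ_x`, used only for `x` with `θ({x}) ≥ 1`. -/
def erase (θ : Configuration S) (x : S) : Configuration S where
  mult y := if y = x then θ.mult y - 1 else θ.mult y
  locallyFinite B hB := (θ.locallyFinite B hB).subset fun y hy =>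
    ⟨hy.1, fun h => hy.2 (by simp [h])⟩

/-- The Borel `σ`-algebra of the vague topology, as the `σ`-algebra generated by the counting maps
`θ ↦ θ(A)`, with `A` a bounded Borel set. -/
instance [MeasurableSpace S] : MeasurableSpace (Configuration S) :=
  ⨆ (A : Set S) (_ : MeasurableSet A ∧ Bornology.IsBounded A),
    MeasurableSpace.comap (fun θ : Configuration S => θ.count A) ⊤

end Configuration

/-! ### Correlation functions and determinantal random point fields -/

section Determinantal

variable {S : Type*} [PseudoMetricSpace S] [MeasurableSpace S]

/-- `ρ` is an `n`-point correlation function of `μ` with respect to the reference measure `dx = ν`: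
it is non-negative, permutation invariant and measurable, and for disjoint bounded Borel sets
`A₁, …, A_m`, and `k₁ + ⋯ + k_m = n`,
`∫_{A₁^{k₁} × ⋯ × A_m^{k_m}} ρ dx = ∫ ∏ᵢ θ(Aᵢ)! / (θ(Aᵢ) - kᵢ)! dμ`.
The map `c` tells in which of the sets each of the `n` variables ranges, and so `kᵢ` is the size
of its fibre over `i`; as `ρ` is permutation invariant, the order of the variables is immaterial. -/
structure IsCorrelationFunction (ν : Measure S) (μ : Measure (Configuration S)) (n : ℕ)
    (ρ : (Fin n → S) → ℝ) : Prop where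
  nonneg : ∀ x, 0 ≤ ρ x
  symm : ∀ (σ : Equiv.Perm (Fin n)) (x : Fin n → S), ρ (x ∘ σ) = ρ x
  measurable : Measurable ρ
  lintegral_eq : ∀ (m : ℕ) (A : Fin m → Set S) (c : Fin n → Fin m),
    (∀ i, MeasurableSet (A i) ∧ Bornology.IsBounded (A i)) →
    Pairwise (fun i j => Disjoint (A i) (A j)) →
    ∫⁻ x in {x : Fin n → S | ∀ l, x l ∈ A (c l)}, ENNReal.ofReal (ρ x) ∂(Measure.pi fun _ => ν) =
      ∫⁻ θ, ∏ i, ((θ.count (A i)).descFactorial (Nat.card {l // c l = i}) : ℝ≥0∞) ∂μ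

/-- `μ` has the correlation functions `ρₙ(x₁, …, xₙ) = det (k(xᵢ, xⱼ))`, for all `n`, with
respect to `ν`. -/
def IsDeterminantal (ν : Measure S) (μ : Measure (Configuration S)) (k : S → S → ℂ) : Prop :=
  ∃ ρ : (n : ℕ) → (Fin n → S) → ℝ, (∀ n, IsCorrelationFunction ν μ n (ρ n)) ∧
    ∀ n x, (ρ n x : ℂ) = (Matrix.of fun i j => k (x i) (x j)).det

/-- The bounded operator `T` on `L²(S, ν)` has the integral kernel `k`. -/
def HasKernel (ν : Measure S) (T : Lp ℂ 2 ν →L[ℂ] Lp ℂ 2 ν) (k : S → S → ℂ) : Prop :=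
  ∀ f : Lp ℂ 2 ν, ∀ᵐ x ∂ν, Integrable (fun y => k x y * f y) ν ∧ T f x = ∫ y, k x y * f y ∂ν

end Determinantal

/-- A bounded operator `T` on a Hilbert space is of trace class: `∑ᵢ ⟨eᵢ, |T| eᵢ⟩ < ∞` for
orthonormal bases `(eᵢ)`, where `|T| = (T* T)^{1/2}`. -/
def IsTraceClass {H : Type*} [NormedAddCommGroup H] [InnerProductSpace ℂ H] [CompleteSpace H]
    (T : H →L[ℂ] H) : Prop :=
  ∀ (w : Set H) (b : HilbertBasis w ℂ H),
    Summable fun i => (inner ℂ (b i) (CFC.abs T (b i))).re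

/-! ### The state space of the particles -/

/-- The open set `U` has smooth boundary: near each boundary point it is the sublevel set of a
smooth function without critical points. -/
def HasSmoothBoundary {d : ℕ} (U : Set (EuclideanSpace ℝ (Fin d))) : Prop :=
  ∀ p ∈ frontier U, ∃ (V : Set (EuclideanSpace ℝ (Fin d))) (φ : EuclideanSpace ℝ (Fin d) → ℝ),
    IsOpen V ∧ p ∈ V ∧ ContDiffOn ℝ ∞ φ V ∧ (∀ x ∈ V, fderiv ℝ φ x ≠ 0) ∧
      ∀ x ∈ V, x ∈ U ↔ φ x < 0

/-- `E` is the closure of a (non-empty) connected open set with smooth boundary. -/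
def IsClosedSmoothDomain {d : ℕ} (E : Set (EuclideanSpace ℝ (Fin d))) : Prop :=
  ∃ U : Set (EuclideanSpace ℝ (Fin d)),
    IsOpen U ∧ IsConnected U ∧ HasSmoothBoundary U ∧ E = closure U

/-- The Lebesgue measure `dx` on `E`. -/
abbrev lebesgue {d : ℕ} (E : Set (EuclideanSpace ℝ (Fin d))) : Measure E :=
  Measure.comap Subtype.val volume

/-! ### The canonical pre-Dirichlet form -/

section Form

variable {d : ℕ} {E : Set (EuclideanSpace ℝ (Fin d))}

/-- The part `(-r, r)ᵈ ∩ E` of a cube, as a subset of `E`. -/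
def cube (E : Set (EuclideanSpace ℝ (Fin d))) (r : ℝ) : Set E :=
  {x | ∀ j, |(x : EuclideanSpace ℝ (Fin d)) j| < r}

/-- `f` is local: measurable with respect to `σ[π_r]` for some `r`, where
`π_r(θ) = θ(· ∩ (-r, r)ᵈ)`. -/
def IsLocal (f : Configuration E → ℝ) : Prop :=
  ∃ r : ℝ, Measurable[MeasurableSpace.comap (Configuration.restrict (cube E r)) inferInstance] f

open scoped Classical in
/-- The function `(x₁, …, xₙ) ↦ f(η + δ_{x₁} + ⋯ + δ_{xₙ})` on `Eⁿ`, extended by zero to `(ℝᵈ)ⁿ`;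
the values outside `Eⁿ` are never used. -/
def coordFun (f : Configuration E → ℝ) (η : Configuration E) (n : ℕ)
    (x : Fin n → EuclideanSpace ℝ (Fin d)) : ℝ :=
  if h : ∀ i, x i ∈ E then f (η.addPoints fun i => ⟨x i, h i⟩) else 0

/-- `f` is smooth: it is a smooth function, up to the boundary of `E`, of the positions of any
finite number of particles, when the other particles (`η`, possibly infinitely many) are fixed.
With `η = 0` this is smoothness of `f` as a function on `Eⁿ`. -/
def IsSmooth (f : Configuration E → ℝ) : Prop :=
  ∀ (η : Configuration E) (n : ℕ), ContDiffOn ℝ ∞ (coordFun f η n) {x | ∀ i, x i ∈ E}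

/-- The gradient of `f` at `θ` in the position of a particle of `θ` that sits at `x`. -/
def particleGradient (f : Configuration E → ℝ) (θ : Configuration E) (x : E) :
    EuclideanSpace ℝ (Fin d) :=
  gradientWithin (fun y => coordFun f (θ.erase x) 1 fun _ => y) E x

/-- The square field `𝔻[f, g](θ) = ½ ∑ᵢ ∂f/∂xᵢ · ∂g/∂xᵢ`, where `θ = ∑ᵢ δ_{xᵢ}`. The sum over the
particles is a sum over sites weighted by multiplicity; it is finite when `f` is local. -/
def squareField (f g : Configuration E → ℝ) (θ : Configuration E) : ℝ :=
  (1 / 2) * ∑ᶠ x : E, (θ.mult x : ℝ) * inner ℝ (particleGradient f θ x) (particleGradient g θ x)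

/-- `ℰ(f, g) = ∫ 𝔻[f, g] dμ`. -/
def energy (μ : Measure (Configuration E)) (f g : Configuration E → ℝ) : ℝ :=
  ∫ θ, squareField f g θ ∂μ

/-- The domain: local smooth functions `f ∈ L²(μ)` with `ℰ(f, f) < ∞`. -/
def preDomain (μ : Measure (Configuration E)) : Set (Configuration E → ℝ) :=
  {f | IsLocal f ∧ IsSmooth f ∧ MemLp f 2 μ ∧ Integrable (squareField f f) μ}

end Form

/-- Closability on `L²(μ)` of the form `ℰ` with domain `D`: if a sequence in `D` is `ℰ`-Cauchy and
converges to `0` in `L²(μ)`, then its energies converge to `0`. (Constant sequences show that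
`ℰ(f, f) = 0` whenever `f = 0` almost everywhere.) -/
def IsClosable {Ω : Type*} [MeasurableSpace Ω] (μ : Measure Ω) (D : Set (Ω → ℝ))
    (ℰ : (Ω → ℝ) → (Ω → ℝ) → ℝ) : Prop :=
  ∀ u : ℕ → Ω → ℝ, (∀ n, u n ∈ D) →
    Tendsto (fun n => eLpNorm (u n) 2 μ) atTop (𝓝 0) →
    Tendsto (fun p : ℕ × ℕ => ℰ (u p.1 - u p.2) (u p.1 - u p.2)) atTop (𝓝 0) →
    Tendsto (fun n => ℰ (u n) (u n)) atTop (𝓝 0)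

end PointField

end

open PointField

/-!
A kernel that is continuous and belongs to a positive operator is positive definite, and the trace
class property makes its diagonal integrable over `E` (`lintegral_diag_lt_top`): the averages of the
kernel over small balls are quadratic forms of the operator, which are dominated by the averages of
a finite measure, and these converge almost everywhere by Lebesgue differentiation. Hence almost
every configuration is finite, and Hadamard's inequality `det (k(xᵢ, xⱼ)) ≤ ∏ᵢ k(xᵢ, xᵢ)` dominates
the correlation functions by products of one continuous integrable function
(`IsDeterminantal.exists_hasDominatedCorrelations`).

For finite configurations, inclusion and exclusion expresses the law of the positions on the event
that there are exactly `n` particles through the correlation functions: it has the density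
`∑ⱼ (-1)ʲ / j! ∫ ρ_{n+j}(x, y) dy` with respect to Lebesgue measure on `Eⁿ`
(`HasDominatedCorrelations.janossyMeasure_eq_withDensity`). By the domination the series converges
locally uniformly, so that this density is continuous. Since `∂E` is a null set, it may be regarded
as a density on the open set `(int E)ⁿ`.

On such an event the form is therefore a sum of forms `∫ |∂ₑ v|² s dy`, with `s` continuous. These
are closable (`tendsto_eLpNorm_fderiv_zero`): the `L²(s dy)` limit of the derivatives of a null
sequence is locally integrable on the open set `{s > 0}`, where integration by parts against test
functions shows that it vanishes, and the complement of that set does not count. So the energy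
carried by each of the events tends to zero. The energy is the sum over `n` of these parts
(`energy_eq`), and the Cauchy property bounds the parts beyond any finite number of them.
-/

noncomputable section

namespace PointField

/-! ### Hadamard's inequality -/

open scoped ComplexOrder in
/-- Hadamard's inequality for unit diagonals: the eigenvalues `λᵢ` have mean one, and
`λ ≤ exp (λ - 1)`. -/
theorem _root_.Matrix.PosSemidef.re_det_le_one {n : ℕ} {A : Matrix (Fin n) (Fin n) ℂ}
    (hA : A.PosSemidef) (h1 : ∀ i, A i i = 1) : A.det.re ≤ 1 := by
  have hE := hA.1
  have h0 : ∀ i, 0 ≤ hE.eigenvalues i := hA.eigenvalues_nonneg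
  have htr : ∑ i, hE.eigenvalues i = n := by
    have := hE.trace_eq_sum_eigenvalues
    have h2 : A.trace = (n : ℂ) := by simp [Matrix.trace, h1]
    rw [h2] at this
    apply Complex.ofReal_injective
    push_cast
    exact this.symm
  have hdet : A.det.re = ∏ i, hE.eigenvalues i := by
    have : A.det = ((∏ i, hE.eigenvalues i : ℝ) : ℂ) := by
      rw [hE.det_eq_prod_eigenvalues]
      push_cast
      rfl
    rw [this, Complex.ofReal_re]
  rw [hdet]
  calc ∏ i, hE.eigenvalues i ≤ ∏ i, Real.exp (hE.eigenvalues i - 1) := by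
        apply Finset.prod_le_prod (fun i _ => h0 i)
        intro i _
        have := Real.add_one_le_exp (hE.eigenvalues i - 1)
        linarith
    _ = 1 := by
        rw [← Real.exp_sum]
        simp [htr]

open scoped ComplexOrder in
/-- Hadamard's inequality. -/
theorem _root_.Matrix.PosSemidef.re_det_le_prod_diag {n : ℕ} {A : Matrix (Fin n) (Fin n) ℂ}
    (hA : A.PosSemidef) : A.det.re ≤ ∏ i, (A i i).re := by
  have hd : ∀ i, (((A i i).re : ℝ) : ℂ) = A i i := fun i => by
    have := Complex.nonneg_iff.1 (hA.diag_nonneg (i := i))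
    apply Complex.ext <;> simp [this.2.symm]
  have hd0 : ∀ i, 0 ≤ (A i i).re := fun i => (Complex.nonneg_iff.1 (hA.diag_nonneg (i := i))).1
  by_cases hz : ∃ i, A i i = 0
  · -- a vanishing diagonal entry forces a vanishing eigenvalue: the basis vector is in the kernel
    obtain ⟨i, hi⟩ := hz
    have hv : A.mulVec (Pi.single i 1) = 0 := by
      rw [← hA.dotProduct_mulVec_zero_iff]
      simp [hi]
    have : A.det = 0 := Matrix.exists_mulVec_eq_zero_iff.1 ⟨Pi.single i 1, by simp, hv⟩
    rw [this]
    exact Finset.prod_nonneg fun i _ => hd0 i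
  · push Not at hz
    have hpos : ∀ i, 0 < (A i i).re := fun i => lt_of_le_of_ne (hd0 i) fun h => hz i (by
      rw [← hd i, ← h]; simp)
    -- scaling by the diagonal matrix `c` makes the diagonal entries equal to one
    set c : Fin n → ℂ := fun i => (((Real.sqrt (A i i).re)⁻¹ : ℝ) : ℂ) with hc
    have hB := hA.conjTranspose_mul_mul_same (Matrix.diagonal c)
    have hcs : (Matrix.diagonal c).conjTranspose = Matrix.diagonal c := by
      rw [Matrix.diagonal_conjTranspose]
      congr 1
      ext i
      simp [hc]
    rw [hcs] at hB
    have hcc : ∀ i, c i * c i = (((A i i).re⁻¹ : ℝ) : ℂ) := fun i => by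
      rw [hc]; simp only; rw [← Complex.ofReal_mul, ← mul_inv, Real.mul_self_sqrt (hd0 i)]
    have h1 := hB.re_det_le_one (fun i => by
      rw [Matrix.mul_diagonal, Matrix.diagonal_mul, mul_right_comm, hcc]
      nth_rw 2 [← hd i]
      rw [← Complex.ofReal_mul, inv_mul_cancel₀ (hpos i).ne']
      simp)
    rw [Matrix.det_mul, Matrix.det_mul, mul_right_comm, Matrix.det_diagonal,
      ← Finset.prod_mul_distrib] at h1
    simp only [hcc] at h1
    rw [← Complex.ofReal_prod, Complex.re_ofReal_mul, Finset.prod_inv_distrib] at h1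
    have hp : 0 < ∏ i, (A i i).re := Finset.prod_pos fun i _ => hpos i
    rwa [inv_mul_le_iff₀ hp, mul_one] at h1

/-! ### The boundary of a smooth domain -/

/-- The boundary of an open set with smooth boundary is a null set: it is locally a regular level
set, so at none of its points can it have Lebesgue density one: in a direction in which the defining
function increases, it misses a fixed proportion of every small ball. -/
theorem HasSmoothBoundary.volume_frontier {d : ℕ} {U : Set (EuclideanSpace ℝ (Fin d))}
    (hU : HasSmoothBoundary U) (hUo : IsOpen U) : volume (frontier U) = 0 := by
  set F := frontier U
  have hae := Besicovitch.ae_tendsto_measure_inter_div (volume : Measure (EuclideanSpace ℝ (Fin d))) F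
  rw [← Measure.restrict_eq_zero, ← ae_eq_bot, ← Filter.eventually_false_iff_eq_bot]
  filter_upwards [hae, ae_restrict_mem isClosed_frontier.measurableSet] with p hp hpF
  obtain ⟨V, φ, hV, hpV, hφ, hφ', hφU⟩ := hU p hpF
  have hzero : ∀ x ∈ V, x ∈ F → φ x = 0 := by
    intro x hx hxF
    have hxc : x ∈ closure U := hxF.1
    have hxn : x ∉ U := by
      intro h
      exact hxF.2 (hUo.interior_eq.symm ▸ h)
    apply le_antisymm
    · by_contra hcon
      push Not at hcon
      have hc : ContinuousAt φ x := (hφ.continuousOn.continuousAt (hV.mem_nhds hx))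
      have hev : ∀ᶠ y in 𝓝 x, 0 < φ y ∧ y ∈ V := (hc.eventually_const_lt hcon).and (hV.mem_nhds hx)
      obtain ⟨y, hy, hyU⟩ := mem_closure_iff_nhds.1 hxc _ hev
      exact absurd ((hφU y hy.2).1 hyU) (not_lt.2 hy.1.le)
    · by_contra hcon
      push Not at hcon
      exact hxn ((hφU x hx).2 hcon)
  set a := fderiv ℝ φ p with ha
  have hane : a ≠ 0 := hφ' p hpV
  obtain ⟨v, hv⟩ : ∃ v, a v ≠ 0 := by
    by_contra h; push Not at h
    exact hane (ContinuousLinearMap.ext h)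
  have hv0 : v ≠ 0 := fun h => hv (by simp [h])
  -- a direction of norm `1/2` in which `φ` increases
  obtain ⟨w, hwn, hw⟩ : ∃ w, ‖w‖ = 1 / 2 ∧ 0 < a w := by
    have hn : 0 < ‖v‖ := norm_pos_iff.2 hv0
    rcases lt_or_gt_of_ne hv with h | h
    · refine ⟨(-(1 / 2) * ‖v‖⁻¹) • v, ?_, ?_⟩
      · rw [norm_smul]; simp; field_simp
      · rw [map_smul, smul_eq_mul]
        have : 0 < ‖v‖⁻¹ := inv_pos.2 hn
        nlinarith [mul_pos this (neg_pos.2 h)]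
    · refine ⟨((1 / 2) * ‖v‖⁻¹) • v, ?_, ?_⟩
      · rw [norm_smul]; simp; field_simp
      · rw [map_smul, smul_eq_mul]
        have : 0 < ‖v‖⁻¹ := inv_pos.2 hn
        nlinarith [mul_pos this h]
  have han : 0 < ‖a‖ := norm_pos_iff.2 hane
  set δ : ℝ := min (1 / 2) (a w / (2 * ‖a‖)) with hδ
  have hδ0 : 0 < δ := lt_min (by norm_num) (by positivity)
  have hδ1 : δ ≤ 1 / 2 := min_le_left _ _
  have hδ2 : ‖a‖ * δ ≤ a w / 2 := by
    have : δ ≤ a w / (2 * ‖a‖) := min_le_right _ _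
    calc ‖a‖ * δ ≤ ‖a‖ * (a w / (2 * ‖a‖)) := by gcongr
      _ = a w / 2 := by field_simp
  have hder : HasFDerivAt φ a p :=
    ((hφ.contDiffAt (hV.mem_nhds hpV)).differentiableAt (by simp)).hasFDerivAt
  have hsmall : ∀ᶠ x in 𝓝 p, ‖φ x - φ p - a (x - p)‖ ≤ (a w / 4) * ‖x - p‖ ∧ x ∈ V :=
    (hder.isLittleO.def (by positivity)).and (hV.mem_nhds hpV)
  obtain ⟨r₀, hr₀, hr₀s⟩ := Metric.nhds_basis_closedBall.eventually_iff.1 hsmall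
  -- by linearization, a ball of radius `δ r` inside the ball of radius `r` misses the boundary
  have hdisj : ∀ r, 0 < r → r ≤ r₀ → Metric.closedBall (p + r • w) (δ * r) ⊆
      Metric.closedBall p r \ F := by
    intro r hr hr' x hx
    rw [Metric.mem_closedBall, dist_eq_norm] at hx
    have hxp : ‖x - p‖ ≤ r := by
      calc ‖x - p‖ = ‖(x - (p + r • w)) + r • w‖ := by congr 1; abel
        _ ≤ ‖x - (p + r • w)‖ + ‖r • w‖ := norm_add_le _ _
        _ ≤ δ * r + r * (1 / 2) := by
            rw [norm_smul, hwn, Real.norm_of_nonneg hr.le]; gcongr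
        _ ≤ r := by nlinarith
    refine ⟨by rwa [Metric.mem_closedBall, dist_eq_norm], fun hxF => ?_⟩
    obtain ⟨h1, hxV⟩ := hr₀s (x := x) (by rw [Metric.mem_closedBall, dist_eq_norm]; linarith)
    rw [hzero x hxV hxF, hzero p hpV hpF, sub_zero, zero_sub, norm_neg] at h1
    have h2 : a (x - p) = a (x - (p + r • w)) + r * a w := by
      have : x - p = (x - (p + r • w)) + r • w := by abel
      rw [this, map_add, map_smul, smul_eq_mul]
    have h3 : |a (x - (p + r • w))| ≤ ‖a‖ * (δ * r) :=
      (a.le_opNorm _).trans (by gcongr)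
    have h4 : ‖a‖ * (δ * r) ≤ a w / 2 * r := by nlinarith
    have h5 := (abs_le.1 h3).1
    have h6 : a (x - p) ≤ a w / 4 * r := (le_abs_self _).trans (h1.trans (by gcongr))
    nlinarith [mul_pos hw hr]
  have hlow : ∀ᶠ r in 𝓝[>] (0 : ℝ), volume (F ∩ Metric.closedBall p r) /
      volume (Metric.closedBall p r) ≤ 1 - ENNReal.ofReal (δ ^ d) := by
    filter_upwards [Ioc_mem_nhdsGT hr₀] with r hr
    have hr0 : 0 < r := hr.1
    have hB := hdisj r hr.1 hr.2
    have hvp : volume (Metric.closedBall p r) ≠ 0 := (Metric.measure_closedBall_pos _ _ hr0).ne'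
    have hvt : volume (Metric.closedBall p r) ≠ ⊤ := measure_closedBall_lt_top.ne
    have hscale : volume (Metric.closedBall (p + r • w) (δ * r)) =
        ENNReal.ofReal (δ ^ d) * volume (Metric.closedBall p r) := by
      have := Measure.addHaar_closedBall_mul (volume : Measure (EuclideanSpace ℝ (Fin d)))
        (p + r • w) hδ0.le hr0.le
      rw [this, Measure.addHaar_closedBall_center]
      simp [Measure.addHaar_closedBall_center volume p]
    have hle : volume (F ∩ Metric.closedBall p r) ≤
        volume (Metric.closedBall p r) - volume (Metric.closedBall (p + r • w) (δ * r)) := by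
      rw [← measure_sdiff (hB.trans Set.sdiff_subset)
        Metric.isClosed_closedBall.measurableSet.nullMeasurableSet measure_closedBall_lt_top.ne]
      apply measure_mono
      rintro x ⟨hxF, hx⟩
      exact ⟨hx, fun h => (hB h).2 hxF⟩
    rw [ENNReal.div_le_iff hvp hvt]
    refine hle.trans ?_
    rw [hscale, ENNReal.sub_mul (fun _ _ => hvt), one_mul]
  have := le_of_tendsto hp hlow
  have h7 : (1 : ℝ≥0∞) - ENNReal.ofReal (δ ^ d) < 1 :=
    ENNReal.sub_lt_self ENNReal.one_ne_top one_ne_zero (ENNReal.ofReal_pos.2 (by positivity)).ne'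
  exact absurd this (not_le.2 h7)

/-! ### Positive operators of trace class with a continuous kernel -/

/-- The quadratic form of a positive trace class operator is a sum of squares of square summable
functionals: `⟨u, T u⟩ = ∑ᵢ |⟨u, hᵢ⟩|²`, with `hᵢ = T^{1/2} eᵢ` for an orthonormal basis `(eᵢ)`. -/
theorem IsTraceClass.exists_hasSum_inner {H : Type*} [NormedAddCommGroup H] [InnerProductSpace ℂ H]
    [CompleteSpace H] {T : H →L[ℂ] H} (htr : IsTraceClass T) (hpos : T.IsPositive) :
    ∃ (w : Set H) (h : w → H), (∀ u, HasSum (fun i => ‖inner ℂ u (h i)‖ ^ 2) (inner ℂ u (T u)).re) ∧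
      Summable fun i => ‖h i‖ ^ 2 := by
  obtain ⟨w, b, -⟩ := exists_hilbertBasis ℂ H
  have hT0 : 0 ≤ T := (ContinuousLinearMap.nonneg_iff_isPositive T).2 hpos
  set Q := CFC.sqrt T with hQ
  have hQQ : Q * Q = T := CFC.sqrt_mul_sqrt_self T hT0
  have hQpos : Q.IsPositive := (ContinuousLinearMap.nonneg_iff_isPositive Q).1 (CFC.sqrt_nonneg T)
  have hsym : ∀ u v, inner ℂ (Q u) v = inner ℂ u (Q v) := hQpos.isSelfAdjoint.isSymmetric
  have hquad : ∀ u, (inner ℂ u (T u)).re = ‖Q u‖ ^ 2 := by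
    intro u
    rw [← hQQ, mul_apply_eq_comp, ← hsym, @norm_sq_eq_re_inner ℂ]
    rfl
  refine ⟨w, fun i => Q (b i), fun u => ?_, ?_⟩
  · have h1 := b.hasSum_inner_mul_inner (Q u) (Q u)
    have h2 := (Complex.hasSum_iff _ _).1 h1 |>.1
    convert h2 using 1
    · ext i
      rw [hsym, ← inner_conj_symm (b i), hsym, RCLike.mul_conj]
      norm_cast
    · rw [hquad, @norm_sq_eq_re_inner ℂ]; rfl
  · have := htr w b
    rw [CFC.abs_of_nonneg T hT0] at this
    simpa only [hquad] using this

section Kernel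

variable {S : Type*} [MetricSpace S] [ProperSpace S] [MeasurableSpace S] [BorelSpace S]
  (ν : Measure S) [IsFiniteMeasureOnCompacts ν]

/-- The indicator function of the closed ball of radius `r` about `x`, normalized to have integral
one, as an element of `L²`. -/
def ballAverage (x : S) (r : ℝ) : Lp ℂ 2 ν :=
  ((ν.real (Metric.closedBall x r))⁻¹ : ℂ) • indicatorConstLp 2
    Metric.isClosed_closedBall.measurableSet (measure_closedBall_lt_top (μ := ν) (x := x) (r := r)).ne
    (1 : ℂ)

theorem inner_ballAverage (x : S) (r : ℝ) (f : Lp ℂ 2 ν) :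
    inner ℂ (ballAverage ν x r) f = ⨍ s in Metric.closedBall x r, f s ∂ν := by
  rw [ballAverage, inner_smul_left, L2.inner_indicatorConstLp_one, setAverage_eq]
  simp

variable {ν} in
theorem HasKernel.apply_ballAverage {T : Lp ℂ 2 ν →L[ℂ] Lp ℂ 2 ν} {k : S → S → ℂ}
    (hT : HasKernel ν T k) (y : S) (r : ℝ) :
    ∀ᵐ s ∂ν, T (ballAverage ν y r) s = ⨍ t in Metric.closedBall y r, k s t ∂ν := by
  have hco : ⇑(ballAverage ν y r) =ᵐ[ν] fun t => ((ν.real (Metric.closedBall y r))⁻¹ : ℂ) *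
      (Metric.closedBall y r).indicator (fun _ => (1 : ℂ)) t := by
    unfold ballAverage
    filter_upwards [Lp.coeFn_smul ((ν.real (Metric.closedBall y r))⁻¹ : ℂ) (indicatorConstLp 2
      Metric.isClosed_closedBall.measurableSet
      (measure_closedBall_lt_top (μ := ν) (x := y) (r := r)).ne (1 : ℂ)),
      indicatorConstLp_coeFn (p := 2) (hs := Metric.isClosed_closedBall.measurableSet)
      (hμs := (measure_closedBall_lt_top (μ := ν) (x := y) (r := r)).ne) (c := (1 : ℂ))]
      with t h1 h2
    rw [h1, Pi.smul_apply, h2, smul_eq_mul]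
  filter_upwards [hT (ballAverage ν y r)] with s hs
  rw [hs.2, setAverage_eq]
  have : (fun t => k s t * ballAverage ν y r t) =ᵐ[ν] (Metric.closedBall y r).indicator
      fun t => ((ν.real (Metric.closedBall y r))⁻¹ : ℂ) * k s t := by
    filter_upwards [hco] with t ht
    rw [ht]
    by_cases h : t ∈ Metric.closedBall y r <;> simp [h, mul_comm]
  rw [integral_congr_ae this, integral_indicator Metric.isClosed_closedBall.measurableSet,
    integral_const_mul, Complex.real_smul]
  push_cast
  rfl

variable [ν.IsOpenPosMeasure]

variable {ν} in
theorem HasKernel.tendsto_inner_ballAverage {T : Lp ℂ 2 ν →L[ℂ] Lp ℂ 2 ν} {k : S → S → ℂ}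
    (hT : HasKernel ν T k) (hk : Continuous fun p : S × S => k p.1 p.2) (x y : S) :
    Tendsto (fun r => inner ℂ (ballAverage ν x r) (T (ballAverage ν y r))) (𝓝[>] 0)
      (𝓝 (k x y)) := by
  rw [Metric.nhds_basis_closedBall.tendsto_right_iff]
  intro δ hδ
  have hev : ∀ᶠ p : S × S in 𝓝 (x, y), k p.1 p.2 ∈ Metric.closedBall (k x y) δ :=
    hk.continuousAt.eventually_mem (Metric.closedBall_mem_nhds _ hδ)
  obtain ⟨r₀, hr₀, hr₀s⟩ := Metric.nhds_basis_closedBall.eventually_iff.1 hev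
  filter_upwards [Ioc_mem_nhdsGT hr₀] with r hr
  have hB : ∀ z : S, ν (Metric.closedBall z r) ≠ 0 := fun z =>
    (Metric.measure_closedBall_pos _ _ hr.1).ne'
  have hB' : ∀ z : S, ν (Metric.closedBall z r) ≠ ⊤ := fun z => measure_closedBall_lt_top.ne
  rw [inner_ballAverage]
  apply (convex_closedBall (k x y) δ).set_average_mem Metric.isClosed_closedBall (hB x) (hB' x)
  · filter_upwards [ae_restrict_of_ae (hT.apply_ballAverage y r),
      ae_restrict_mem Metric.isClosed_closedBall.measurableSet] with s hs hsx
    rw [hs]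
    apply (convex_closedBall (k x y) δ).set_average_mem Metric.isClosed_closedBall (hB y) (hB' y)
    · filter_upwards [ae_restrict_mem Metric.isClosed_closedBall.measurableSet] with t ht
      refine hr₀s (x := (s, t)) ?_
      rw [← closedBall_prod_same]
      exact ⟨Metric.closedBall_subset_closedBall hr.2 hsx,
        Metric.closedBall_subset_closedBall hr.2 ht⟩
    · exact (hk.comp (by fun_prop : Continuous fun t => (s, t))).continuousOn.integrableOn_compact
        (isCompact_closedBall _ _)
  · have := (Lp.memLp (T (ballAverage ν y r))).restrict (Metric.closedBall x r)
    have hfin : IsFiniteMeasure (ν.restrict (Metric.closedBall x r)) :=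
      ⟨by rw [Measure.restrict_apply_univ]; exact measure_closedBall_lt_top⟩
    exact this.integrable (by norm_num)

open scoped ComplexOrder in
variable {ν} in
/-- The continuous kernel of a positive operator is positive definite. -/
theorem HasKernel.posSemidef {T : Lp ℂ 2 ν →L[ℂ] Lp ℂ 2 ν} {k : S → S → ℂ}
    (hT : HasKernel ν T k) (hk : Continuous fun p : S × S => k p.1 p.2) (hpos : T.IsPositive)
    {n : ℕ} (x : Fin n → S) : (Matrix.of fun i j => k (x i) (x j)).PosSemidef := by
  apply Matrix.PosSemidef.of_dotProduct_mulVec_nonneg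
  · ext i j
    simp only [Matrix.conjTranspose_apply, Matrix.of_apply]
    have h1 := (hT.tendsto_inner_ballAverage hk (x j) (x i)).star
    have h2 := hT.tendsto_inner_ballAverage hk (x i) (x j)
    refine tendsto_nhds_unique h1 (h2.congr fun r => ?_)
    have h3 : inner ℂ (T (ballAverage ν (x i) r)) (ballAverage ν (x j) r) = _ :=
      hpos.isSelfAdjoint.isSymmetric _ _
    exact h3.symm.trans (inner_conj_symm _ _).symm
  · intro c
    have h1 : Tendsto (fun r => ∑ i, ∑ j, star (c i) * (inner ℂ (ballAverage ν (x i) r)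
        (T (ballAverage ν (x j) r)) * c j)) (𝓝[>] 0) (𝓝 (∑ i, ∑ j, star (c i) *
          (k (x i) (x j) * c j))) :=
      tendsto_finsetSum _ fun i _ => tendsto_finsetSum _ fun j _ =>
        ((hT.tendsto_inner_ballAverage hk (x i) (x j)).mul_const _).const_mul _
    have h2 : star c ⬝ᵥ (Matrix.of fun i j => k (x i) (x j)).mulVec c =
        ∑ i, ∑ j, star (c i) * (k (x i) (x j) * c j) := by
      simp [dotProduct, Matrix.mulVec, Finset.mul_sum]
    rw [h2]
    refine ge_of_tendsto' h1 fun r => ?_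
    have h3 := hpos.inner_nonneg_right (∑ j, c j • ballAverage ν (x j) r)
    convert h3 using 1
    simp only [map_sum, map_smul, sum_inner]
    refine Finset.sum_congr rfl fun i _ => ?_
    rw [inner_sum]
    refine Finset.sum_congr rfl fun j _ => ?_
    rw [inner_smul_left, inner_smul_right, RCLike.star_def]
    ring

omit [ν.IsOpenPosMeasure] in
theorem ofReal_norm_inner_ballAverage_sq_le (h : Lp ℂ 2 ν) (x : S) (r : ℝ) :
    ENNReal.ofReal (‖inner ℂ (ballAverage ν x r) h‖ ^ 2) ≤
      (∫⁻ s in Metric.closedBall x r, ‖h s‖ₑ ^ 2 ∂ν) / ν (Metric.closedBall x r) := by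
  set B := Metric.closedBall x r
  have hBt : ν B ≠ ⊤ := measure_closedBall_lt_top.ne
  rcases eq_or_ne (ν B) 0 with h0 | h0
  · rw [inner_ballAverage, Measure.restrict_eq_zero.2 h0]
    simp
  rw [inner_ballAverage, ENNReal.ofReal_pow (norm_nonneg _), ofReal_norm, setAverage_eq,
    enorm_smul]
  have h1 : ‖∫ s in B, h s ∂ν‖ₑ ≤ (∫⁻ s in B, ‖h s‖ₑ ^ 2 ∂ν) ^ (1 / 2 : ℝ) * (ν B) ^ (1 / 2 : ℝ) := by
    refine (enorm_integral_le_lintegral_enorm _).trans ?_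
    have := ENNReal.lintegral_mul_le_Lp_mul_Lq (ν.restrict B)
      (Real.holderConjugate_iff.2 ⟨by norm_num, by norm_num⟩ : (2 : ℝ).HolderConjugate 2)
      (Lp.stronglyMeasurable h).enorm.aemeasurable (aemeasurable_const (b := (1 : ℝ≥0∞)))
    simpa using this
  have h2 : ‖(ν.real B)⁻¹‖ₑ = (ν B)⁻¹ := by
    rw [← ofReal_norm, Real.norm_of_nonneg (by positivity),
      ENNReal.ofReal_inv_of_pos (lt_of_le_of_ne measureReal_nonneg
        ((measureReal_ne_zero_iff hBt).2 h0).symm), ofReal_measureReal hBt]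
  calc (‖(ν.real B)⁻¹‖ₑ * ‖∫ s in B, h s ∂ν‖ₑ) ^ 2
      ≤ ((ν B)⁻¹ * ((∫⁻ s in B, ‖h s‖ₑ ^ 2 ∂ν) ^ (1 / 2 : ℝ) * (ν B) ^ (1 / 2 : ℝ))) ^ 2 := by
        rw [h2]; gcongr
    _ = (ν B)⁻¹ * ((ν B)⁻¹ * ν B) * ∫⁻ s in B, ‖h s‖ₑ ^ 2 ∂ν := by
        have h3 : ∀ a : ℝ≥0∞, (a ^ (1 / 2 : ℝ)) ^ 2 = a := fun a => by
          rw [← ENNReal.rpow_natCast, ← ENNReal.rpow_mul]; norm_num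
        rw [mul_pow, mul_pow, h3, h3]
        ring
    _ = _ := by rw [ENNReal.inv_mul_cancel h0 hBt, mul_one, mul_comm, div_eq_mul_inv]

omit [ν.IsOpenPosMeasure] in
variable {ν} in
/-- With `hᵢ = T^{1/2} eᵢ` for an orthonormal basis `(eᵢ)`, the measure with density `∑ᵢ |hᵢ|²` has
mass `tr T`, and its averages dominate the averages of the kernel of `T` near the diagonal. -/
theorem IsTraceClass.exists_measure {T : Lp ℂ 2 ν →L[ℂ] Lp ℂ 2 ν} (htr : IsTraceClass T)
    (hpos : T.IsPositive) : ∃ R : Measure S, IsFiniteMeasure R ∧ ∀ (x : S) (r : ℝ),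
      ENNReal.ofReal (inner ℂ (ballAverage ν x r) (T (ballAverage ν x r))).re ≤
        R (Metric.closedBall x r) / ν (Metric.closedBall x r) := by
  obtain ⟨w, h, hpars, hsum⟩ := htr.exists_hasSum_inner hpos
  have hint : ∀ i, ∫⁻ s, ‖h i s‖ₑ ^ 2 ∂ν = ENNReal.ofReal (‖h i‖ ^ 2) := by
    intro i
    rw [ENNReal.ofReal_pow (norm_nonneg _), ofReal_norm, Lp.enorm_def,
      eLpNorm_eq_lintegral_rpow_enorm_toReal (by norm_num) (by norm_num), ← ENNReal.rpow_natCast,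
      ← ENNReal.rpow_mul]
    norm_num
  refine ⟨Measure.sum fun i => ν.withDensity fun s => ‖h i s‖ₑ ^ 2, ⟨?_⟩, fun x r => ?_⟩
  · rw [Measure.sum_apply _ MeasurableSet.univ]
    simp only [withDensity_apply _ MeasurableSet.univ, Measure.restrict_univ, hint]
    rw [← ENNReal.ofReal_tsum_of_nonneg (fun _ => by positivity) hsum]
    exact ENNReal.ofReal_lt_top
  · have hBm : MeasurableSet (Metric.closedBall x r) := Metric.isClosed_closedBall.measurableSet
    rw [Measure.sum_apply _ hBm]
    simp only [withDensity_apply _ hBm]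
    have hp := hpars (ballAverage ν x r)
    rw [← hp.tsum_eq, ENNReal.ofReal_tsum_of_nonneg (fun _ => by positivity) hp.summable,
      div_eq_mul_inv, ← ENNReal.tsum_mul_right]
    exact ENNReal.tsum_le_tsum fun i => ofReal_norm_inner_ballAverage_sq_le ν _ x r

end Kernel

section Domain

variable {d : ℕ} {E : Set (EuclideanSpace ℝ (Fin d))}

theorem IsClosedSmoothDomain.isClosed (hE : IsClosedSmoothDomain E) : IsClosed E := by
  obtain ⟨U, -, -, -, rfl⟩ := hE
  exact isClosed_closure

/-- Almost all points of `E` are interior points. -/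
theorem IsClosedSmoothDomain.volume_diff_interior (hE : IsClosedSmoothDomain E) :
    volume (E \ interior E) = 0 := by
  obtain ⟨U, hU, -, hUs, rfl⟩ := hE
  refine measure_mono_null ?_ (hUs.volume_frontier hU)
  rintro x ⟨hx, hx'⟩
  exact ⟨hx, fun h => hx' (interior_mono subset_closure h)⟩

theorem measurePreserving_val_lebesgue (hE : IsClosed E) :
    MeasurePreserving (Subtype.val : E → EuclideanSpace ℝ (Fin d)) (lebesgue E)
      (volume.restrict E) :=
  measurePreserving_subtype_coe hE.measurableSet

theorem ae_lebesgue_mem_interior (hE : IsClosedSmoothDomain E) :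
    ∀ᵐ x : E ∂(lebesgue E), (x : EuclideanSpace ℝ (Fin d)) ∈ interior E := by
  refine (measurePreserving_val_lebesgue hE.isClosed).quasiMeasurePreserving.tendsto_ae.eventually
    (p := fun x => x ∈ interior E) ?_
  rw [ae_restrict_iff' hE.isClosed.measurableSet, ae_iff]
  convert hE.volume_diff_interior using 2
  ext x; simp

theorem isFiniteMeasureOnCompacts_lebesgue (hE : IsClosed E) :
    IsFiniteMeasureOnCompacts (lebesgue E) := by
  refine ⟨fun C hC => ?_⟩
  rw [(MeasurableEmbedding.subtype_coe hE.measurableSet).comap_apply]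
  exact (hC.image continuous_subtype_val).measure_lt_top

theorem isOpenPosMeasure_lebesgue (hE : IsClosedSmoothDomain E) :
    (lebesgue E).IsOpenPosMeasure := by
  refine ⟨fun O hO hne => ?_⟩
  rw [(MeasurableEmbedding.subtype_coe hE.isClosed.measurableSet).comap_apply]
  obtain ⟨U, hU, -, -, rfl⟩ := hE
  obtain ⟨V, hV, rfl⟩ := isOpen_induced_iff.1 hO
  obtain ⟨x, hx⟩ := hne
  have hVU : (V ∩ U).Nonempty := mem_closure_iff.1 x.2 V hV hx
  refine ((hV.inter hU).measure_pos volume hVU).ne' ∘ fun h => measure_mono_null ?_ h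
  rintro y ⟨hyV, hyU⟩
  exact ⟨⟨y, subset_closure hyU⟩, hyV, rfl⟩

/-- The continuous kernel of a positive trace class operator is integrable along the diagonal. -/
theorem lintegral_diag_lt_top (hE : IsClosedSmoothDomain E)
    {K : Lp ℂ 2 (lebesgue E) →L[ℂ] Lp ℂ 2 (lebesgue E)} (hpos : K.IsPositive)
    {k : E → E → ℂ} (hk : Continuous fun p : E × E => k p.1 p.2)
    (hKk : HasKernel (lebesgue E) K k) (htr : IsTraceClass K) :
    ∫⁻ x, ENNReal.ofReal (k x x).re ∂(lebesgue E) < ⊤ := by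
  have hEc := hE.isClosed
  have := ProperSpace.of_isClosed hEc
  have := isFiniteMeasureOnCompacts_lebesgue hEc
  have := isOpenPosMeasure_lebesgue hE
  have hemb := MeasurableEmbedding.subtype_coe hEc.measurableSet
  have hmp := measurePreserving_val_lebesgue hEc
  obtain ⟨R, hR, hRle⟩ := htr.exists_measure hpos
  set R' : Measure (EuclideanSpace ℝ (Fin d)) := R.map Subtype.val with hR'
  have hae : ∀ᵐ x : E ∂(lebesgue E), ENNReal.ofReal (k x x).re ≤ R'.rnDeriv volume x := by
    have h1 := hmp.quasiMeasurePreserving.ae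
      (ae_restrict_of_ae (s := E) (Besicovitch.ae_tendsto_rnDeriv R' volume))
    filter_upwards [h1, ae_lebesgue_mem_interior hE] with x hx hxi
    have h2 := ENNReal.tendsto_ofReal ((Complex.continuous_re.tendsto _).comp
      (hKk.tendsto_inner_ballAverage hk x x))
    refine le_of_tendsto_of_tendsto h2 hx ?_
    obtain ⟨r₀, hr₀, hr₀s⟩ := Metric.nhds_basis_closedBall.mem_iff.1
      (isOpen_interior.mem_nhds hxi)
    filter_upwards [Ioc_mem_nhdsGT hr₀] with r hr
    have hsub : Metric.closedBall (x : EuclideanSpace ℝ (Fin d)) r ⊆ E :=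
      (Metric.closedBall_subset_closedBall hr.2).trans (hr₀s.trans interior_subset)
    have hpre : Metric.closedBall x r = Subtype.val ⁻¹' Metric.closedBall x.1 r := rfl
    have h3 : R' (Metric.closedBall x.1 r) = R (Metric.closedBall x r) := by
      rw [hpre, hR', hemb.map_apply]
    have h4 : volume (Metric.closedBall x.1 r) = lebesgue E (Metric.closedBall x r) := by
      rw [hpre, hemb.comap_apply, Subtype.image_preimage_coe, Set.inter_eq_right.2 hsub]
    rw [h3, h4]
    exact hRle x r
  calc ∫⁻ x, ENNReal.ofReal (k x x).re ∂(lebesgue E)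
      ≤ ∫⁻ x : E, R'.rnDeriv volume x ∂(lebesgue E) := lintegral_mono_ae hae
    _ = ∫⁻ x in E, R'.rnDeriv volume x ∂volume := by
        rw [← hmp.map_eq, hemb.lintegral_map]
    _ ≤ ∫⁻ x, R'.rnDeriv volume x ∂volume := setLIntegral_le_lintegral _ _
    _ ≤ R' Set.univ := Measure.lintegral_rnDeriv_le
    _ < ⊤ := by
        rw [hR', hemb.map_apply]
        exact measure_lt_top _ _

end Domain

/-! ### Finite configurations -/

namespace Configuration

section Finite

variable {S : Type*} [PseudoMetricSpace S]

/-- The configuration without particles. -/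
def empty : Configuration S where
  mult _ := 0
  locallyFinite B _ := by simp

/-- The configuration `δ_{x₁} + ⋯ + δ_{xₙ}`. -/
def ofPoints {n : ℕ} (x : Fin n → S) : Configuration S := empty.addPoints x

/-- The configuration has finitely many particles. -/
def IsFinite (θ : Configuration S) : Prop := (Function.support θ.mult).Finite

theorem mult_ofPoints {n : ℕ} (x : Fin n → S) (y : S) :
    (ofPoints x).mult y = Nat.card {i // x i = y} := by
  simp [ofPoints, addPoints, empty]

theorem mult_ofPoints_ne_zero {n : ℕ} {x : Fin n → S} {y : S} :
    (ofPoints x).mult y ≠ 0 ↔ y ∈ Set.range x := by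
  rw [mult_ofPoints, Nat.card_ne_zero]
  constructor
  · rintro ⟨⟨i⟩, -⟩
    exact ⟨i.1, i.2⟩
  · rintro ⟨i, hi⟩
    exact ⟨⟨⟨i, hi⟩⟩, inferInstance⟩

theorem ofPoints_comp_equiv {n m : ℕ} (x : Fin n → S) (e : Fin m ≃ Fin n) :
    ofPoints (x ∘ e) = ofPoints x := by
  ext y
  rw [mult_ofPoints, mult_ofPoints]
  exact Nat.card_congr (e.subtypeEquiv fun _ => Iff.rfl)

theorem count_ofPoints {n : ℕ} (x : Fin n → S) (A : Set S) :
    (ofPoints x).count A = Nat.card {i // x i ∈ A} := by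
  classical
  have h : (ofPoints x).count A =
      ∑ y ∈ (Finset.univ.filter fun i => x i ∈ A).image x, (ofPoints x).mult y := by
    apply finsum_mem_eq_sum_of_inter_support_eq
    ext y
    simp only [Set.mem_inter_iff, Function.mem_support, mult_ofPoints_ne_zero, Finset.coe_image,
      Finset.coe_filter, Finset.mem_univ, true_and, Set.mem_image, Set.mem_range,
      Set.mem_ofPred_eq]
    constructor
    · rintro ⟨hy, i, rfl⟩
      exact ⟨⟨i, hy, rfl⟩, i, rfl⟩
    · rintro ⟨⟨i, hi, rfl⟩, -⟩
      exact ⟨hi, i, rfl⟩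
  rw [h, Nat.card_eq_fintype_card, Fintype.card_subtype, Finset.card_eq_sum_card_image x]
  refine Finset.sum_congr rfl fun y hy => ?_
  obtain ⟨i, hi, rfl⟩ := Finset.mem_image.1 hy
  rw [mult_ofPoints, Nat.card_eq_fintype_card, Fintype.card_subtype, Finset.filter_filter]
  congr 1
  ext j
  simp only [Finset.mem_filter, Finset.mem_univ, true_and]
  constructor
  · intro h
    exact ⟨h ▸ (Finset.mem_filter.1 hi).2, h⟩
  · exact fun h => h.2

theorem count_univ_ofPoints {n : ℕ} (x : Fin n → S) : (ofPoints x).count Set.univ = n := by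
  classical
  rw [count_ofPoints]
  simp

theorem IsFinite.exists_eq_ofPoints {θ : Configuration S} (h : θ.IsFinite) :
    ∃ p : Σ n : ℕ, (Fin n → S), θ = ofPoints p.2 := by
  classical
  have : Fintype (Function.support θ.mult) := h.fintype
  let I := Σ y : Function.support θ.mult, Fin (θ.mult y)
  let e : Fin (Fintype.card I) ≃ I := (Fintype.equivFin I).symm
  refine ⟨⟨Fintype.card I, fun i => (e i).1⟩, ?_⟩
  ext y
  rw [mult_ofPoints]
  have h1 : Nat.card {i // ((e i).1 : S) = y} = Nat.card {p : I // (p.1 : S) = y} :=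
    Nat.card_congr (e.subtypeEquiv fun _ => Iff.rfl)
  rw [h1]
  by_cases hy : θ.mult y = 0
  · rw [hy]
    symm
    rw [Nat.card_eq_zero]
    left
    exact ⟨fun p => p.1.1.2 (by rw [p.2, hy])⟩
  · have h2 : {p : I // (p.1 : S) = y} ≃ Fin (θ.mult y) :=
      { toFun := fun p => Fin.cast (by rw [p.2]) p.1.2
        invFun := fun j => ⟨⟨⟨y, hy⟩, j⟩, rfl⟩
        left_inv := by
          rintro ⟨⟨⟨z, hz⟩, j⟩, hj⟩
          obtain rfl : z = y := hj
          rfl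
        right_inv := fun j => rfl }
    rw [Nat.card_congr h2, Nat.card_fin]

theorem card_le_count {θ : Configuration S} {A : Set S} (hA : (A ∩ Function.support θ.mult).Finite)
    (t : Finset S) (htA : ↑t ⊆ A) (ht : ∀ y ∈ t, θ.mult y ≠ 0) : t.card ≤ θ.count A := by
  rw [count, finsum_mem_eq_sum_of_inter_support_eq (s := A) (t := hA.toFinset) _ (by
    ext y; simp)]
  calc t.card = ∑ y ∈ t, 1 := by simp
    _ ≤ ∑ y ∈ t, θ.mult y := Finset.sum_le_sum fun y hy => Nat.one_le_iff_ne_zero.2 (ht y hy)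
    _ ≤ _ := Finset.sum_le_sum_of_subset fun y hy => by simpa using ⟨htA hy, ht y hy⟩

theorem count_le_count {θ : Configuration S} {A B : Set S} (h : A ⊆ B)
    (hB : (B ∩ Function.support θ.mult).Finite) : θ.count A ≤ θ.count B := by
  have hA := hB.subset (Set.inter_subset_inter_left _ h)
  rw [count, count, finsum_mem_eq_sum_of_inter_support_eq (s := A) (t := hA.toFinset) _ (by
    ext y; simp), finsum_mem_eq_sum_of_inter_support_eq (s := B) (t := hB.toFinset) _ (by
    ext y; simp)]
  refine Finset.sum_le_sum_of_subset fun y hy => ?_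
  simp only [Set.Finite.mem_toFinset] at hy ⊢
  exact ⟨h hy.1, hy.2⟩

theorem IsFinite.count_mono {θ : Configuration S} (hθ : θ.IsFinite) {A B : Set S} (h : A ⊆ B) :
    θ.count A ≤ θ.count B :=
  count_le_count h (Set.Finite.subset hθ Set.inter_subset_right)

theorem IsFinite.eventually_count_inter_ball {θ : Configuration S} (hθ : θ.IsFinite) (A : Set S)
    (o : S) : ∀ᶠ R : ℕ in atTop, θ.count (A ∩ Metric.ball o R) = θ.count A := by
  classical
  obtain ⟨⟨n, x⟩, rfl⟩ := hθ.exists_eq_ofPoints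
  have h : ∀ᶠ R : ℕ in atTop, ∀ i, x i ∈ Metric.ball o R := by
    rw [eventually_all]
    intro i
    exact (tendsto_natCast_atTop_atTop (R := ℝ)).eventually_gt_atTop (dist (x i) o)
  filter_upwards [h] with R hR
  rw [count_ofPoints, count_ofPoints]
  exact Nat.card_congr (Equiv.subtypeEquivRight fun i => by simp [hR i])

theorem isFinite_iff_exists_count_le (θ : Configuration S) (o : S) :
    θ.IsFinite ↔ ∃ C : ℕ, ∀ R : ℕ, θ.count (Metric.ball o R) ≤ C := by
  constructor
  · exact fun h => ⟨θ.count Set.univ, fun R => h.count_mono (Set.subset_univ _)⟩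
  · rintro ⟨C, hC⟩
    by_contra hinf
    obtain ⟨t, ht, htc⟩ := Set.Infinite.exists_subset_card_eq hinf (C + 1)
    obtain ⟨R, hR⟩ : ∃ R : ℕ, ∀ y ∈ t, y ∈ Metric.ball o R := by
      have h : ∀ᶠ R : ℕ in atTop, ∀ y ∈ t, y ∈ Metric.ball o R := by
        rw [Finset.eventually_all]
        intro i _
        exact (tendsto_natCast_atTop_atTop (R := ℝ)).eventually_gt_atTop (dist i o)
      exact h.exists
    have := card_le_count (θ.locallyFinite (Metric.ball o R) Metric.isBounded_ball) t
      (fun y hy => hR y hy) (fun y hy => ht hy)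
    have := hC R
    omega

end Finite

section Measurable

variable {S : Type*} [PseudoMetricSpace S] [MeasurableSpace S]

theorem measurable_count {A : Set S} (hA : MeasurableSet A) (hb : Bornology.IsBounded A) :
    Measurable fun θ : Configuration S => θ.count A := by
  apply Measurable.mono (comap_measurable _) _ le_rfl
  exact le_iSup₂_of_le A ⟨hA, hb⟩ le_rfl

variable [OpensMeasurableSpace S] [Nonempty S]

theorem measurableSet_isFinite : MeasurableSet {θ : Configuration S | θ.IsFinite} := by
  obtain ⟨o⟩ := ‹Nonempty S›
  simp only [fun θ : Configuration S => isFinite_iff_exists_count_le θ o, Set.ofPred_exists,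
    Set.ofPred_forall]
  exact MeasurableSet.iUnion fun C => MeasurableSet.iInter fun R =>
    measurable_count measurableSet_ball Metric.isBounded_ball measurableSet_Iic

open scoped Classical in
theorem measurable_count_of_isFinite {A : Set S} (hA : MeasurableSet A) :
    Measurable fun θ : Configuration S => if θ.IsFinite then θ.count A else 0 := by
  obtain ⟨o⟩ := id ‹Nonempty S›
  refine measurable_of_tendsto_metrizable (f := fun (R : ℕ) (θ : Configuration S) =>
    if θ.IsFinite then θ.count (A ∩ Metric.ball o R) else 0) (fun R => ?_) ?_
  · exact Measurable.ite measurableSet_isFinite (measurable_count (hA.inter measurableSet_ball)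
      (Metric.isBounded_ball.subset Set.inter_subset_right)) measurable_const
  · rw [tendsto_pi_nhds]
    intro θ
    by_cases h : θ.IsFinite
    · simp only [h, if_true]
      exact tendsto_const_nhds.congr' ((h.eventually_count_inter_ball A o).mono fun _ h => h.symm)
    · simp [h]

omit [OpensMeasurableSpace S] [Nonempty S] in
theorem measurable_ofPoints (n : ℕ) : Measurable (ofPoints : (Fin n → S) → Configuration S) := by
  classical
  refine measurable_iff_comap_le.2 ?_
  unfold instMeasurableSpace
  rw [MeasurableSpace.comap_iSup]
  refine iSup_le fun A => ?_
  rw [MeasurableSpace.comap_iSup]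
  refine iSup_le fun hA => ?_
  rw [MeasurableSpace.comap_comp, ← measurable_iff_comap_le]
  have : ((fun θ : Configuration S => θ.count A) ∘ ofPoints) =
      fun x : Fin n → S => ∑ i, if x i ∈ A then 1 else 0 := by
    ext x
    rw [Function.comp_apply, count_ofPoints, Nat.card_eq_fintype_card, Fintype.card_subtype,
      Finset.card_filter]
  rw [this]
  exact Finset.measurable_sum _ fun i _ =>
    Measurable.ite (measurable_pi_apply i hA.1) measurable_const measurable_const

end Measurable

end Configuration

/-! ### Products of disjoint sets and counts of injections -/

section Cells

variable {S : Type*} [MeasurableSpace S]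

/-- The products `A_{c 1} × ⋯ × A_{c n}` of pairwise equal or disjoint measurable sets. -/
def cells (S : Type*) [MeasurableSpace S] (n : ℕ) : Set (Set (Fin n → S)) :=
  {C | ∃ (m : ℕ) (A : Fin m → Set S) (c : Fin n → Fin m), (∀ i, MeasurableSet (A i)) ∧
    Pairwise (fun i j => Disjoint (A i) (A j)) ∧ C = {x | ∀ l, x l ∈ A (c l)}}

theorem univ_mem_cells (n : ℕ) : Set.univ ∈ cells S n :=
  ⟨1, fun _ => Set.univ, fun _ => 0, fun _ => MeasurableSet.univ,
    fun i j hij => absurd (Subsingleton.elim i j) hij, by simp⟩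

theorem measurableSet_cell {n m : ℕ} {A : Fin m → Set S} (hA : ∀ i, MeasurableSet (A i))
    (c : Fin n → Fin m) : MeasurableSet {x : Fin n → S | ∀ l, x l ∈ A (c l)} := by
  rw [Set.ofPred_forall]
  exact MeasurableSet.iInter fun l => measurable_pi_apply l (hA _)

theorem isPiSystem_cells (n : ℕ) : IsPiSystem (cells S n) := by
  rintro _ ⟨m, A, c, hA, hAd, rfl⟩ _ ⟨m', A', c', hA', hAd', rfl⟩ -
  refine ⟨m * m', fun p => A (finProdFinEquiv.symm p).1 ∩ A' (finProdFinEquiv.symm p).2,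
    fun l => finProdFinEquiv (c l, c' l), fun p => (hA _).inter (hA' _), fun p q hpq => ?_, ?_⟩
  · have : finProdFinEquiv.symm p ≠ finProdFinEquiv.symm q := fun h =>
      hpq (finProdFinEquiv.symm.injective h)
    rw [Ne, Prod.ext_iff, not_and_or] at this
    rcases this with h | h
    · exact (hAd h).mono Set.inter_subset_left Set.inter_subset_left
    · exact (hAd' h).mono Set.inter_subset_right Set.inter_subset_right
  · ext x
    simp [forall_and]

theorem generateFrom_cells (n : ℕ) :
    (MeasurableSpace.pi : MeasurableSpace (Fin n → S)) = MeasurableSpace.generateFrom (cells S n) := by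
  apply le_antisymm
  · refine iSup_le fun l => ?_
    rintro _ ⟨B, hB, rfl⟩
    -- the preimage of `B` is a union of products whose factors are `B` or its complement
    have h : (fun x : Fin n → S => x l) ⁻¹' B = ⋃ (c : Fin n → Fin 2) (_ : c l = 0),
        {x | ∀ l', x l' ∈ (![B, Bᶜ] : Fin 2 → Set S) (c l')} := by
      classical
      ext x
      simp only [Set.mem_preimage, Set.mem_iUnion, Set.mem_ofPred_eq, exists_prop]
      constructor
      · intro hx
        refine ⟨fun l' => if x l' ∈ B then 0 else 1, by simp [hx], fun l' => ?_⟩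
        by_cases h : x l' ∈ B <;> simp [h]
      · rintro ⟨c, hc, h⟩
        have := h l
        rw [hc] at this
        exact this
    rw [h]
    refine MeasurableSet.iUnion fun c => MeasurableSet.iUnion fun _ =>
      MeasurableSpace.measurableSet_generateFrom ⟨2, ![B, Bᶜ], c, ?_, ?_, rfl⟩
    · intro i
      fin_cases i
      · exact hB
      · exact hB.compl
    · intro i j hij
      fin_cases i <;> fin_cases j
      · exact absurd rfl hij
      · exact disjoint_compl_right
      · exact disjoint_compl_left
      · exact absurd rfl hij
  · apply MeasurableSpace.generateFrom_le
    rintro _ ⟨m, A, c, hA, -, rfl⟩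
    exact measurableSet_cell hA c

end Cells

section Embeddings

/-- The number of injections that send each index into the set prescribed for it. -/
theorem card_embedding_mem {ι S : Type*} [Fintype ι] {n m : ℕ} (x : ι → S) {A : Fin m → Set S}
    (hA : Pairwise fun i j => Disjoint (A i) (A j)) (c : Fin n → Fin m) :
    Nat.card {f : Fin n ↪ ι // ∀ l, x (f l) ∈ A (c l)} =
      ∏ i, (Nat.card {a // x a ∈ A i}).descFactorial (Nat.card {l // c l = i}) := by
  classical
  let e : {f : Fin n ↪ ι // ∀ l, x (f l) ∈ A (c l)} ≃
      ((i : Fin m) → ({l // c l = i} ↪ {a // x a ∈ A i})) :=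
    { toFun := fun f i => ⟨fun l => ⟨f.1 l.1, by have := f.2 l.1; rwa [l.2] at this⟩,
        fun l l' h => Subtype.ext (f.1.injective (Subtype.ext_iff.1 h))⟩
      invFun := fun g => ⟨⟨fun l => (g (c l) ⟨l, rfl⟩).1, fun l l' h => by
        have hc : c l = c l' := by
          by_contra hne
          have h1 := (g (c l) ⟨l, rfl⟩).2
          have h2 := (g (c l') ⟨l', rfl⟩).2
          simp only at h
          rw [h] at h1
          exact Set.disjoint_left.1 (hA hne) h1 h2
        have : ∀ (i : Fin m) (hi : c l = i), (g (c l) ⟨l, rfl⟩).1 = (g i ⟨l, hi⟩).1 := by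
          rintro _ rfl; rfl
        simp only at h
        rw [this _ hc] at h
        exact congrArg Subtype.val ((g (c l')).injective (Subtype.ext h))⟩,
        fun l => (g (c l) ⟨l, rfl⟩).2⟩
      left_inv := fun f => by ext l; rfl
      right_inv := fun g => by
        ext i ⟨l, rfl⟩
        rfl }
  rw [Nat.card_congr e, Nat.card_eq_fintype_card, Fintype.card_pi]
  refine Finset.prod_congr rfl fun i _ => ?_
  rw [Fintype.card_embedding_eq, Nat.card_eq_fintype_card, Nat.card_eq_fintype_card]

theorem card_embedding_castAdd (n j N : ℕ) (f : Fin n ↪ Fin N) :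
    Nat.card {g : Fin (n + j) ↪ Fin N // (Fin.castAddEmb j).trans g = f} =
      (N - n).descFactorial j := by
  classical
  let e : (Fin (n + j) ↪ Fin N) ≃ Σ f : Fin n ↪ Fin N, Fin j ↪ ↥(Set.range f)ᶜ :=
    (Equiv.embeddingCongr finSumFinEquiv.symm (Equiv.refl _)).trans
      Equiv.sumEmbeddingEquivSigmaEmbeddingRestricted
  have he : ∀ g, (e g).1 = (Fin.castAddEmb j).trans g := fun g => by
    ext l
    rfl
  have e2 : {g : Fin (n + j) ↪ Fin N // (Fin.castAddEmb j).trans g = f} ≃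
      (Fin j ↪ ↥(Set.range f)ᶜ) :=
    (e.subtypeEquiv fun g => by rw [he]).trans
      (Equiv.sigmaSubtype f)
  rw [Nat.card_congr e2, Nat.card_eq_fintype_card, Fintype.card_embedding_eq, Fintype.card_fin,
    Fintype.card_compl_set, Fintype.card_fin, Set.card_range_of_injective f.injective,
    Fintype.card_fin]

end Embeddings

open PointField.Configuration

/-! ### Factorial measures and Janossy measures -/

section FactorialMeasure

variable {S : Type*} [PseudoMetricSpace S] [MeasurableSpace S]

open scoped Classical in
/-- The `n`-th factorial measure `∑ δ_{(x_{i₁}, …, x_{iₙ})}` of a finite configuration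
`δ_{x₁} + ⋯ + δ_{x_N}`, a sum over the `n`-tuples of distinct indices `i₁, …, iₙ`. For infinite
configurations it is set to zero. -/
def factorialMeasure (n : ℕ) (θ : Configuration S) : Measure (Fin n → S) :=
  if h : θ.IsFinite then
    ∑ f : Fin n ↪ Fin h.exists_eq_ofPoints.choose.1,
      Measure.dirac (h.exists_eq_ofPoints.choose.2 ∘ f)
  else 0

theorem factorialMeasure_of_not_isFinite (n : ℕ) {θ : Configuration S} (h : ¬ θ.IsFinite) :
    factorialMeasure n θ = 0 := by
  simp [factorialMeasure, h]

theorem exists_factorialMeasure_apply {θ : Configuration S} (h : θ.IsFinite) :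
    ∃ (N : ℕ) (x : Fin N → S), θ = ofPoints x ∧ ∀ (n : ℕ) (B : Set (Fin n → S)), MeasurableSet B →
      factorialMeasure n θ B = (Nat.card {f : Fin n ↪ Fin N // x ∘ f ∈ B} : ℝ≥0∞) := by
  classical
  refine ⟨_, _, h.exists_eq_ofPoints.choose_spec, fun n B hB => ?_⟩
  rw [factorialMeasure, dif_pos h, Measure.finsetSum_apply, Nat.card_eq_fintype_card,
    Fintype.card_subtype, Finset.card_filter, Nat.cast_sum]
  refine Finset.sum_congr rfl fun f _ => ?_
  rw [Measure.dirac_apply' _ hB]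
  by_cases hf : h.exists_eq_ofPoints.choose.2 ∘ f ∈ B <;> simp [hf]

theorem factorialMeasure_cell {n m : ℕ} {θ : Configuration S} (hθ : θ.IsFinite)
    {A : Fin m → Set S} (hA : ∀ i, MeasurableSet (A i))
    (hAd : Pairwise fun i j => Disjoint (A i) (A j)) (c : Fin n → Fin m) :
    factorialMeasure n θ {x | ∀ l, x l ∈ A (c l)} =
      ∏ i, ((θ.count (A i)).descFactorial (Nat.card {l // c l = i}) : ℝ≥0∞) := by
  obtain ⟨N, x, rfl, h⟩ := exists_factorialMeasure_apply hθ
  rw [h n _ (measurableSet_cell hA c)]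
  simp only [count_ofPoints]
  rw [← Nat.cast_prod, ← card_embedding_mem x hAd c]
  rfl

theorem factorialMeasure_univ {n : ℕ} {θ : Configuration S} (hθ : θ.IsFinite) :
    factorialMeasure n θ Set.univ = ((θ.count Set.univ).descFactorial n : ℝ≥0∞) := by
  obtain ⟨N, x, rfl, h⟩ := exists_factorialMeasure_apply hθ
  rw [h n _ MeasurableSet.univ, count_univ_ofPoints]
  simp [Fintype.card_embedding_eq]

instance (n : ℕ) (θ : Configuration S) : IsFiniteMeasure (factorialMeasure n θ) := by
  refine ⟨?_⟩
  by_cases h : θ.IsFinite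
  · rw [factorialMeasure_univ h]
    exact ENNReal.natCast_lt_top _
  · rw [factorialMeasure_of_not_isFinite n h]
    simp

/-- An `n`-tuple of distinct indices extends in `(N - n)ⱼ` ways to an `(n + j)`-tuple. -/
theorem factorialMeasure_castAdd {n : ℕ} (j : ℕ) {θ : Configuration S} (hθ : θ.IsFinite)
    {B : Set (Fin n → S)} (hB : MeasurableSet B) :
    factorialMeasure (n + j) θ ((fun z i => z (Fin.castAdd j i)) ⁻¹' B) =
      factorialMeasure n θ B * ((θ.count Set.univ - n).descFactorial j : ℝ≥0∞) := by
  classical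
  obtain ⟨N, x, rfl, h⟩ := exists_factorialMeasure_apply hθ
  have hm : Measurable fun (z : Fin (n + j) → S) (i : Fin n) => z (Fin.castAdd j i) := by fun_prop
  rw [h _ _ (hm hB), h _ _ hB, count_univ_ofPoints]
  norm_cast
  let e : {g : Fin (n + j) ↪ Fin N // x ∘ g ∈ (fun z i => z (Fin.castAdd j i)) ⁻¹' B} ≃
      Σ f : {f : Fin n ↪ Fin N // x ∘ f ∈ B},
        {g : Fin (n + j) ↪ Fin N // (Fin.castAddEmb j).trans g = f.1} :=
    { toFun := fun g => ⟨⟨(Fin.castAddEmb j).trans g.1, g.2⟩, ⟨g.1, rfl⟩⟩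
      invFun := fun p => ⟨p.2.1, by have := p.1.2; rw [← p.2.2] at this; exact this⟩
      left_inv := fun g => rfl
      right_inv := by
        rintro ⟨⟨f, hf⟩, ⟨g, hg⟩⟩
        have hg' : (Fin.castAddEmb j).trans g = f := hg
        subst hg'
        rfl }
  rw [Nat.card_congr e, Nat.card_sigma]
  simp only [card_embedding_castAdd]
  simp [Nat.card_eq_fintype_card]

theorem factorialMeasure_preimage_ofPoints {n : ℕ} {θ : Configuration S} (hθ : θ.IsFinite)
    (hn : θ.count Set.univ = n) {s : Set (Configuration S)} (hs : MeasurableSet s) :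
    factorialMeasure n θ (ofPoints ⁻¹' s) = n.factorial * s.indicator 1 θ := by
  classical
  obtain ⟨N, x, rfl, h⟩ := exists_factorialMeasure_apply hθ
  rw [count_univ_ofPoints] at hn
  subst hn
  rw [h _ _ (measurable_ofPoints _ hs)]
  have hperm : ∀ f : Fin N ↪ Fin N, ofPoints (x ∘ f) = ofPoints x := fun f =>
    ofPoints_comp_equiv x (f.equivOfFiniteSelfEmbedding)
  by_cases hx : ofPoints x ∈ s
  · rw [Set.indicator_of_mem hx, Pi.one_apply, mul_one]
    norm_cast
    rw [Nat.card_congr (Equiv.subtypeUnivEquiv fun f => by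
      rw [Set.mem_preimage, hperm]; exact hx), Nat.card_eq_fintype_card, Fintype.card_embedding_eq]
    simp [Nat.descFactorial_self]
  · rw [Set.indicator_of_notMem hx, mul_zero, Nat.cast_eq_zero, Nat.card_eq_zero]
    left
    exact ⟨fun f => hx (by have := f.2; rwa [Set.mem_preimage, hperm] at this)⟩

variable [OpensMeasurableSpace S] [Nonempty S]

theorem measurable_factorialMeasure (n : ℕ) :
    Measurable (factorialMeasure n : Configuration S → Measure (Fin n → S)) := by
  classical
  have key : ∀ C ∈ cells S n, Measurable fun θ : Configuration S => factorialMeasure n θ C := by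
    rintro _ ⟨m, A, c, hA, hAd, rfl⟩
    have : (fun θ : Configuration S => factorialMeasure n θ {x | ∀ l, x l ∈ A (c l)}) =
        fun θ => if θ.IsFinite then
          ∏ i, (((if θ.IsFinite then θ.count (A i) else 0).descFactorial
            (Nat.card {l // c l = i}) : ℕ) : ℝ≥0∞) else 0 := by
      ext θ
      by_cases h : θ.IsFinite
      · simp only [h, if_true]
        exact factorialMeasure_cell h hA hAd c
      · simp [h, factorialMeasure_of_not_isFinite n h]
    rw [this]
    refine Measurable.ite measurableSet_isFinite ?_ measurable_const
    refine Finset.measurable_prod _ fun i _ => ?_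
    exact (measurable_from_top (f := fun a : ℕ =>
      ((a.descFactorial (Nat.card {l // c l = i}) : ℕ) : ℝ≥0∞))).comp
        (measurable_count_of_isFinite (hA i))
  exact Measurable.measure_of_isPiSystem (generateFrom_cells n) (isPiSystem_cells n) key
    (key _ (univ_mem_cells n))

/-- The configurations with exactly `n` particles. -/
def withPoints (S : Type*) [PseudoMetricSpace S] (n : ℕ) : Set (Configuration S) :=
  {θ | θ.IsFinite ∧ θ.count Set.univ = n}

theorem measurableSet_withPoints (n : ℕ) : MeasurableSet (withPoints S n) := by
  classical
  have h := measurable_count_of_isFinite (S := S) MeasurableSet.univ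
  have : withPoints S n = {θ | θ.IsFinite} ∩
      (fun θ : Configuration S => if θ.IsFinite then θ.count Set.univ else 0) ⁻¹' {n} := by
    ext θ
    by_cases hθ : θ.IsFinite <;> simp [withPoints, hθ]
  rw [this]
  exact measurableSet_isFinite.inter (h (measurableSet_singleton n))

/-- The measure `B ↦ ∫_{θ(S) = n} #{(x₁, …, xₙ) ∈ B enumerating θ} dμ` on `Sⁿ`. -/
def janossyMeasure (μ : Measure (Configuration S)) (n : ℕ) : Measure (Fin n → S) :=
  (μ.restrict (withPoints S n)).bind (factorialMeasure n)

/-- A configuration with `n` particles is enumerated by `n!` tuples. -/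
theorem map_ofPoints_janossyMeasure (μ : Measure (Configuration S)) (n : ℕ) :
    (janossyMeasure μ n).map ofPoints = (n.factorial : ℝ≥0∞) • μ.restrict (withPoints S n) := by
  ext s hs
  rw [Measure.map_apply (measurable_ofPoints n) hs, janossyMeasure,
    Measure.bind_apply (measurable_ofPoints n hs) (measurable_factorialMeasure n).aemeasurable,
    Measure.smul_apply, smul_eq_mul]
  calc ∫⁻ θ in withPoints S n, factorialMeasure n θ (ofPoints ⁻¹' s) ∂μ
      = ∫⁻ θ in withPoints S n, n.factorial * s.indicator 1 θ ∂μ :=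
        setLIntegral_congr_fun (measurableSet_withPoints n) fun θ hθ =>
          factorialMeasure_preimage_ofPoints hθ.1 hθ.2 hs
    _ = _ := by
        rw [lintegral_const_mul _ (measurable_one.indicator hs), lintegral_indicator_one hs]

theorem lintegral_comp_ofPoints {μ : Measure (Configuration S)} (n : ℕ)
    {h : Configuration S → ℝ≥0∞} (hh : AEMeasurable h μ) :
    ∫⁻ x, h (ofPoints x) ∂(janossyMeasure μ n) =
      n.factorial * ∫⁻ θ in withPoints S n, h θ ∂μ := by
  rw [← lintegral_map' (f := h) _ (measurable_ofPoints n).aemeasurable,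
    map_ofPoints_janossyMeasure, lintegral_smul_measure, smul_eq_mul]
  rw [map_ofPoints_janossyMeasure]
  exact hh.restrict.smul_measure _

theorem sum_restrict_withPoints {μ : Measure (Configuration S)}
    (hμ : ∀ᵐ θ ∂μ, θ.IsFinite) : Measure.sum (fun n => μ.restrict (withPoints S n)) = μ := by
  rw [← Measure.restrict_iUnion _ fun n => measurableSet_withPoints n]
  · apply Measure.restrict_eq_self_of_ae_mem
    filter_upwards [hμ] with θ hθ
    exact Set.mem_iUnion.2 ⟨_, hθ, rfl⟩
  · intro n m hnm
    rw [Function.onFun, Set.disjoint_left]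
    rintro θ ⟨-, h1⟩ ⟨-, h2⟩
    exact hnm (h1.symm.trans h2)

theorem lintegral_eq_tsum_janossyMeasure {μ : Measure (Configuration S)}
    (hμ : ∀ᵐ θ ∂μ, θ.IsFinite) {h : Configuration S → ℝ≥0∞} (hh : AEMeasurable h μ) :
    ∫⁻ θ, h θ ∂μ =
      ∑' n : ℕ, (n.factorial : ℝ≥0∞)⁻¹ * ∫⁻ x, h (ofPoints x) ∂(janossyMeasure μ n) := by
  conv_lhs => rw [← sum_restrict_withPoints hμ]
  rw [lintegral_sum_measure]
  refine tsum_congr fun n => ?_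
  rw [lintegral_comp_ofPoints n hh, ← mul_assoc, ENNReal.inv_mul_cancel, one_mul]
  · exact_mod_cast n.factorial_ne_zero
  · exact ENNReal.natCast_ne_top _

/-- A function on configurations is almost everywhere measurable if it is so as a function of
`n`-tuples of points, for every `n`: integration against the factorial measures, which depend
measurably on the configuration, recovers the function from its symmetric versions. -/
theorem aemeasurable_of_comp_ofPoints [MeasurableSingletonClass S] {μ : Measure (Configuration S)}
    (hμ : ∀ᵐ θ ∂μ, θ.IsFinite) {h : Configuration S → ℝ≥0∞}
    (hh : ∀ n, AEMeasurable (fun x => h (ofPoints x)) (janossyMeasure μ n)) :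
    AEMeasurable h μ := by
  rw [← sum_restrict_withPoints hμ, aemeasurable_sum_measure_iff]
  intro n
  have hκ := measurable_factorialMeasure (S := S) n
  obtain ⟨H, hH, hHe⟩ := hh n
  have h1 := Measure.ae_ae_of_ae_bind hκ.aemeasurable hHe
  refine ⟨fun θ => (n.factorial : ℝ≥0∞)⁻¹ * ∫⁻ x, H x ∂(factorialMeasure n θ),
    (Measure.measurable_lintegral hH |>.comp hκ).const_mul _, ?_⟩
  filter_upwards [h1, ae_restrict_mem (measurableSet_withPoints n)] with θ hθ hθn
  have h2 : ∀ᵐ x ∂(factorialMeasure n θ), h (ofPoints x) = h θ := by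
    classical
    rw [factorialMeasure, dif_pos hθn.1]
    rw [ae_finsetSum_measure_iff]
    intro f _
    rw [ae_dirac_eq, eventually_pure]
    have hN : hθn.1.exists_eq_ofPoints.choose.1 = n := by
      rw [← count_univ_ofPoints hθn.1.exists_eq_ofPoints.choose.2,
        ← hθn.1.exists_eq_ofPoints.choose_spec, hθn.2]
    have hb : Function.Bijective f :=
      (Fintype.bijective_iff_injective_and_card f).2 ⟨f.injective, by simp [hN]⟩
    exact congrArg h ((ofPoints_comp_equiv _ (Equiv.ofBijective f hb)).trans
      hθn.1.exists_eq_ofPoints.choose_spec.symm)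
  rw [lintegral_congr_ae (g := fun _ => h θ)]
  · rw [lintegral_const, factorialMeasure_univ hθn.1, hθn.2, Nat.descFactorial_self, mul_comm (h θ),
      ← mul_assoc, ENNReal.inv_mul_cancel, one_mul]
    · exact_mod_cast n.factorial_ne_zero
    · exact ENNReal.natCast_ne_top _
  · filter_upwards [hθ, h2] with x hx hx2
    rw [← hx, hx2]

end FactorialMeasure

/-! ### Janossy densities -/

section Append

variable {S : Type*}

theorem measurable_finAppend [MeasurableSpace S] (n j : ℕ) :
    Measurable fun p : (Fin n → S) × (Fin j → S) => Fin.append p.1 p.2 := by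
  refine measurable_pi_iff.2 fun i => ?_
  refine Fin.addCases (fun i => ?_) (fun i => ?_) i
  · simp only [Fin.append_left]; fun_prop
  · simp only [Fin.append_right]; fun_prop

theorem continuous_finAppend [TopologicalSpace S] (n j : ℕ) :
    Continuous fun p : (Fin n → S) × (Fin j → S) => Fin.append p.1 p.2 := by
  refine continuous_pi fun i => ?_
  refine Fin.addCases (fun i => ?_) (fun i => ?_) i
  · simp only [Fin.append_left]; fun_prop
  · simp only [Fin.append_right]; fun_prop

theorem map_finAppend_prod_pi [MeasurableSpace S] (ν : Measure S) [SigmaFinite ν] (n j : ℕ) :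
    (((Measure.pi fun _ : Fin n => ν).prod (Measure.pi fun _ : Fin j => ν)).map
      fun p => Fin.append p.1 p.2) = Measure.pi fun _ : Fin (n + j) => ν := by
  symm
  refine Measure.pi_eq fun s hs => ?_
  rw [Measure.map_apply (measurable_finAppend n j) (MeasurableSet.univ_pi hs), Fin.prod_univ_add]
  have : (fun p : (Fin n → S) × (Fin j → S) => Fin.append p.1 p.2) ⁻¹' Set.univ.pi s =
      (Set.univ.pi fun i => s (Fin.castAdd j i)) ×ˢ (Set.univ.pi fun i => s (Fin.natAdd n i)) := by
    ext p
    simp only [Set.mem_preimage, Set.mem_pi, Set.mem_univ, true_imp_iff, Set.mem_prod]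
    constructor
    · intro h
      exact ⟨fun i => by simpa using h (Fin.castAdd j i), fun i => by simpa using h (Fin.natAdd n i)⟩
    · rintro ⟨h1, h2⟩ i
      refine Fin.addCases (fun i => ?_) (fun i => ?_) i
      · simpa using h1 i
      · simpa using h2 i
  rw [this, Measure.prod_prod, Measure.pi_pi, Measure.pi_pi]

end Append

/-- Inclusion and exclusion: `∑ⱼ (-1)ʲ / j! (M)ⱼ` is one if `M = 0` and zero otherwise. -/
theorem tsum_alternating_descFactorial (M : ℕ) :
    ∑' j : ℕ, (-1 : ℝ) ^ j / j.factorial * (M.descFactorial j : ℝ) = if M = 0 then 1 else 0 := by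
  have h1 : ∀ j : ℕ, (-1 : ℝ) ^ j / j.factorial * (M.descFactorial j : ℝ) =
      (-1) ^ j * (M.choose j : ℝ) := fun j => by
    have : (j.factorial : ℝ) ≠ 0 := by exact_mod_cast j.factorial_ne_zero
    rw [Nat.descFactorial_eq_factorial_mul_choose]
    push_cast
    field_simp
  simp only [h1]
  rw [tsum_eq_sum (s := Finset.range (M + 1)) fun j hj => by
    rw [Nat.choose_eq_zero_of_lt (by simpa using hj)]; simp]
  exact_mod_cast Int.alternating_sum_range_choose (n := M)

theorem integral_pi_prod_eq_pow {S : Type*} [MeasurableSpace S] {ν : Measure S}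
    [SigmaFinite ν] (D : S → ℝ) (n : ℕ) :
    ∫ x : Fin n → S, ∏ i, D (x i) ∂(Measure.pi fun _ => ν) = (∫ x, D x ∂ν) ^ n := by
  rw [integral_fintype_prod_eq_prod (fun _ => D)]
  simp

section Janossy

variable {S : Type*} [PseudoMetricSpace S] [MeasurableSpace S] {ν : Measure S}

/-- A system of continuous correlation functions satisfying the bound
`ρₙ(x₁, …, xₙ) ≤ D(x₁) ⋯ D(xₙ)` for a continuous integrable function `D`. For determinantal fields
this is Hadamard's inequality, with `D` the diagonal of the kernel. -/
structure HasDominatedCorrelations (ν : Measure S) (μ : Measure (Configuration S))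
    (ρ : (n : ℕ) → (Fin n → S) → ℝ) (D : S → ℝ) : Prop where
  isCorrelationFunction : ∀ n, IsCorrelationFunction ν μ n (ρ n)
  continuous : ∀ n, Continuous (ρ n)
  nonneg : ∀ x, 0 ≤ D x
  continuous_bound : Continuous D
  integrable_bound : Integrable D ν
  le_prod : ∀ n x, ρ n x ≤ ∏ i, D (x i)

/-- The integral of `ρ_{n+j}(x, y)` over `y`. -/
def marginal (ν : Measure S) (ρ : (n : ℕ) → (Fin n → S) → ℝ) (n j : ℕ) (x : Fin n → S) : ℝ :=
  ∫ y : Fin j → S, ρ (n + j) (Fin.append x y) ∂(Measure.pi fun _ => ν)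

/-- The `n`-th Janossy density `∑ⱼ (-1)ʲ / j! ∫ ρ_{n+j}(x, y) dy`. -/
def janossy (ν : Measure S) (ρ : (n : ℕ) → (Fin n → S) → ℝ) (n : ℕ) (x : Fin n → S) : ℝ :=
  ∑' j : ℕ, (-1) ^ j / j.factorial * marginal ν ρ n j x

namespace HasDominatedCorrelations

variable {μ : Measure (Configuration S)} {ρ : (n : ℕ) → (Fin n → S) → ℝ} {D : S → ℝ}

theorem prod_nonneg (h : HasDominatedCorrelations ν μ ρ D) {n : ℕ} (x : Fin n → S) :
    0 ≤ ∏ i, D (x i) := Finset.prod_nonneg fun _ _ => h.nonneg _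

theorem norm_le (h : HasDominatedCorrelations ν μ ρ D) (n : ℕ) (x : Fin n → S) :
    ‖ρ n x‖ ≤ ∏ i, D (x i) := by
  rw [Real.norm_of_nonneg ((h.isCorrelationFunction n).nonneg x)]
  exact h.le_prod n x

variable [SigmaFinite ν]

theorem integrable_prod (h : HasDominatedCorrelations ν μ ρ D) (n : ℕ) :
    Integrable (fun x : Fin n → S => ∏ i, D (x i)) (Measure.pi fun _ => ν) :=
  Integrable.fintype_prod fun _ => h.integrable_bound

omit [SigmaFinite ν] in
theorem integral_nonneg (h : HasDominatedCorrelations ν μ ρ D) : 0 ≤ ∫ x, D x ∂ν :=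
  MeasureTheory.integral_nonneg h.nonneg

theorem integrable (h : HasDominatedCorrelations ν μ ρ D) (n : ℕ) :
    Integrable (ρ n) (Measure.pi fun _ => ν) :=
  (h.integrable_prod n).mono' (h.isCorrelationFunction n).measurable.aestronglyMeasurable
    (ae_of_all _ (h.norm_le n))

theorem lintegral_lt_top (h : HasDominatedCorrelations ν μ ρ D) (n : ℕ) :
    ∫⁻ x, ENNReal.ofReal (ρ n x) ∂(Measure.pi fun _ => ν) < ⊤ :=
  (h.integrable n).lintegral_lt_top

omit [SigmaFinite ν] in
theorem norm_append_le (h : HasDominatedCorrelations ν μ ρ D) {n j : ℕ} (x : Fin n → S)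
    (y : Fin j → S) :
    ‖ρ (n + j) (Fin.append x y)‖ ≤ (∏ i, D (x i)) * ∏ i, D (y i) := by
  refine (h.norm_le _ _).trans_eq ?_
  rw [Fin.prod_univ_add]
  simp

theorem norm_marginal_le (h : HasDominatedCorrelations ν μ ρ D) (n j : ℕ) (x : Fin n → S) :
    ‖marginal ν ρ n j x‖ ≤ (∏ i, D (x i)) * (∫ x, D x ∂ν) ^ j := by
  rw [← integral_pi_prod_eq_pow D j, ← integral_const_mul]
  exact norm_integral_le_of_norm_le ((h.integrable_prod j).const_mul _)
    (ae_of_all _ fun y => h.norm_append_le x y)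

theorem norm_term_le (h : HasDominatedCorrelations ν μ ρ D) (n j : ℕ) (x : Fin n → S) :
    ‖(-1) ^ j / j.factorial * marginal ν ρ n j x‖ ≤
      (∏ i, D (x i)) * ((∫ x, D x ∂ν) ^ j / j.factorial) := by
  rw [norm_mul, norm_div, norm_pow, norm_neg, norm_one, one_pow, Real.norm_natCast]
  calc 1 / (j.factorial : ℝ) * ‖marginal ν ρ n j x‖
      ≤ 1 / (j.factorial : ℝ) * ((∏ i, D (x i)) * (∫ x, D x ∂ν) ^ j) := by
        gcongr; exact h.norm_marginal_le n j x
    _ = _ := by ring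

theorem norm_janossy_le (h : HasDominatedCorrelations ν μ ρ D) (n : ℕ) (x : Fin n → S) :
    ‖janossy ν ρ n x‖ ≤ (∏ i, D (x i)) * Real.exp (∫ x, D x ∂ν) := by
  refine tsum_of_norm_bounded (HasSum.mul_left _ ?_) (h.norm_term_le n · x)
  rw [Real.exp_eq_exp_ℝ]
  exact NormedSpace.expSeries_div_hasSum_exp _

theorem continuousOn_marginal (h : HasDominatedCorrelations ν μ ρ D) (n j : ℕ) (L : ℝ) :
    ContinuousOn (marginal ν ρ n j) {x | ∏ i, D (x i) < L} := by
  refine continuousOn_of_dominated (bound := fun y => L * ∏ i, D (y i)) (fun x _ => ?_)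
    (fun x hx => ae_of_all _ fun y => ?_) ((h.integrable_prod j).const_mul _)
    (ae_of_all _ fun y => ?_)
  · exact ((h.isCorrelationFunction _).measurable.comp
      ((measurable_finAppend n j).comp measurable_prodMk_left)).aestronglyMeasurable
  · refine (h.norm_append_le x y).trans ?_
    exact mul_le_mul_of_nonneg_right hx.le (h.prod_nonneg y)
  · exact ((h.continuous _).comp ((continuous_finAppend n j).comp
      (Continuous.prodMk_left y))).continuousOn

/-- The series converges uniformly where `∏ᵢ D(xᵢ)` is bounded. -/
theorem continuous_janossy (h : HasDominatedCorrelations ν μ ρ D) (n : ℕ) :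
    Continuous (janossy ν ρ n) := by
  rw [continuous_iff_continuousAt]
  intro x₀
  set L := ∏ i, D (x₀ i) + 1
  have hO : IsOpen {x : Fin n → S | ∏ i, D (x i) < L} :=
    isOpen_lt (continuous_finsetProd _ fun i _ => h.continuous_bound.comp (continuous_apply i))
      continuous_const
  have hx₀ : x₀ ∈ {x : Fin n → S | ∏ i, D (x i) < L} := by
    simp [L]
  refine ContinuousOn.continuousAt ?_ (hO.mem_nhds hx₀)
  have hI := h.integral_nonneg
  have hc : ∀ j : ℕ, ContinuousOn (fun x => (-1) ^ j / (j.factorial : ℝ) * marginal ν ρ n j x)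
      {x | ∏ i, D (x i) < L} := fun j =>
    ContinuousOn.mul continuousOn_const (h.continuousOn_marginal n j L)
  have hs : Summable fun j : ℕ => L * ((∫ x, D x ∂ν) ^ j / (j.factorial : ℝ)) :=
    (Real.summable_pow_div_factorial _).mul_left _
  have hle : ∀ (j : ℕ) (x : Fin n → S), x ∈ {x : Fin n → S | ∏ i, D (x i) < L} →
      ‖(-1) ^ j / (j.factorial : ℝ) * marginal ν ρ n j x‖ ≤
        L * ((∫ x, D x ∂ν) ^ j / (j.factorial : ℝ)) := fun j x hx =>
    (h.norm_term_le n j x).trans (mul_le_mul_of_nonneg_right (le_of_lt hx)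
      (div_nonneg (pow_nonneg hI j) (Nat.cast_nonneg _)))
  exact continuousOn_tsum hc hs hle

variable [OpensMeasurableSpace S] [Nonempty S]

/-- The expected number of particles is finite. -/
theorem ae_isFinite (h : HasDominatedCorrelations ν μ ρ D) : ∀ᵐ θ ∂μ, θ.IsFinite := by
  obtain ⟨o⟩ := id ‹Nonempty S›
  have hmeas : ∀ R : ℕ, Measurable fun θ : Configuration S =>
      ((θ.count (Metric.ball o R) : ℕ) : ℝ≥0∞) := fun R =>
    measurable_from_top.comp (measurable_count measurableSet_ball Metric.isBounded_ball)
  have hle : ∀ R : ℕ, ∫⁻ θ, ((θ.count (Metric.ball o R) : ℕ) : ℝ≥0∞) ∂μ ≤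
      ∫⁻ x, ENNReal.ofReal (ρ 1 x) ∂(Measure.pi fun _ => ν) := by
    intro R
    have := (h.isCorrelationFunction 1).lintegral_eq 1 (fun _ => Metric.ball o R) (fun _ => 0)
      (fun _ => ⟨measurableSet_ball, Metric.isBounded_ball⟩)
      (fun i j hij => absurd (Subsingleton.elim i j) hij)
    simp at this
    rw [← this]
    exact setLIntegral_le_lintegral _ _
  have hmono : ∀ θ : Configuration S, Monotone fun R : ℕ =>
      ((θ.count (Metric.ball o R) : ℕ) : ℝ≥0∞) := by
    intro θ R R' hR
    have hRR : (R : ℝ) ≤ R' := by exact_mod_cast hR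
    have := count_le_count (Metric.ball_subset_ball (x := o) hRR)
      (θ.locallyFinite _ Metric.isBounded_ball)
    simpa using this
  have hsup : ∫⁻ θ, ⨆ R : ℕ, ((θ.count (Metric.ball o R) : ℕ) : ℝ≥0∞) ∂μ < ⊤ := by
    rw [lintegral_iSup hmeas fun R R' hR θ => hmono θ hR]
    exact (iSup_le hle).trans_lt (h.lintegral_lt_top 1)
  filter_upwards [ae_lt_top (.iSup hmeas) hsup.ne] with θ hθ
  rw [isFinite_iff_exists_count_le θ o]
  obtain ⟨C, hC⟩ := ENNReal.exists_nat_gt hθ.ne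
  refine ⟨C, fun R => ?_⟩
  have := (le_iSup (fun R : ℕ => ((θ.count (Metric.ball o R) : ℕ) : ℝ≥0∞)) R).trans hC.le
  exact_mod_cast this

/-- The identity that defines correlation functions holds for unbounded sets as well. -/
theorem lintegral_cell (h : HasDominatedCorrelations ν μ ρ D) {n m : ℕ} {A : Fin m → Set S}
    (hA : ∀ i, MeasurableSet (A i)) (hAd : Pairwise fun i j => Disjoint (A i) (A j))
    (c : Fin n → Fin m) :
    ∫⁻ x in {x : Fin n → S | ∀ l, x l ∈ A (c l)}, ENNReal.ofReal (ρ n x) ∂(Measure.pi fun _ => ν) =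
      ∫⁻ θ, ∏ i, ((θ.count (A i)).descFactorial (Nat.card {l // c l = i}) : ℝ≥0∞) ∂μ := by
  obtain ⟨o⟩ := id ‹Nonempty S›
  set P := Measure.pi fun _ : Fin n => ν
  have hb : ∀ R : ℕ, ∀ i, MeasurableSet (A i ∩ Metric.ball o R) ∧
      Bornology.IsBounded (A i ∩ Metric.ball o R) := fun R i =>
    ⟨(hA i).inter measurableSet_ball, Metric.isBounded_ball.subset Set.inter_subset_right⟩
  have hR := fun R : ℕ => (h.isCorrelationFunction n).lintegral_eq m
    (fun i => A i ∩ Metric.ball o R) c (hb R)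
    (fun i j hij => (hAd hij).mono Set.inter_subset_left Set.inter_subset_left)
  have hleft : Tendsto (fun R : ℕ => ∫⁻ x in {x : Fin n → S | ∀ l, x l ∈ A (c l) ∩ Metric.ball o R},
      ENNReal.ofReal (ρ n x) ∂P) atTop
      (𝓝 (∫⁻ x in {x : Fin n → S | ∀ l, x l ∈ A (c l)}, ENNReal.ofReal (ρ n x) ∂P)) := by
    have hmono : Monotone fun R : ℕ => {x : Fin n → S | ∀ l, x l ∈ A (c l) ∩ Metric.ball o R} := by
      intro R R' hRR' x hx l
      exact ⟨(hx l).1, Metric.ball_subset_ball (by exact_mod_cast hRR') (hx l).2⟩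
    have hun : {x : Fin n → S | ∀ l, x l ∈ A (c l)} =
        ⋃ R : ℕ, {x : Fin n → S | ∀ l, x l ∈ A (c l) ∩ Metric.ball o R} := by
      ext x
      simp only [Set.mem_iUnion, Set.mem_ofPred_eq, Set.mem_inter_iff]
      constructor
      · intro hx
        have hev : ∀ᶠ R : ℕ in atTop, ∀ i, x i ∈ Metric.ball o R := by
          rw [eventually_all]
          intro i
          exact (tendsto_natCast_atTop_atTop (R := ℝ)).eventually_gt_atTop (dist (x i) o)
        obtain ⟨R, hR⟩ := hev.exists
        exact ⟨R, fun l => ⟨hx l, hR l⟩⟩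
      · rintro ⟨R, hR⟩ l
        exact (hR l).1
    rw [hun]
    have := tendsto_measure_iUnion_atTop (μ := P.withDensity fun x => ENNReal.ofReal (ρ n x)) hmono
    rw [withDensity_apply _ (MeasurableSet.iUnion fun R => measurableSet_cell (fun i => (hb R i).1) c)]
      at this
    refine this.congr fun R => ?_
    exact withDensity_apply _ (measurableSet_cell (fun i => (hb R i).1) c)
  have hright : Tendsto (fun R : ℕ => ∫⁻ θ, ∏ i, ((θ.count (A i ∩ Metric.ball o R)).descFactorial
      (Nat.card {l // c l = i}) : ℝ≥0∞) ∂μ) atTop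
      (𝓝 (∫⁻ θ, ∏ i, ((θ.count (A i)).descFactorial (Nat.card {l // c l = i}) : ℝ≥0∞) ∂μ)) := by
    refine lintegral_tendsto_of_tendsto_of_monotone (fun R => ?_) ?_ ?_
    · refine (Finset.measurable_prod _ fun i _ => ?_).aemeasurable
      exact (measurable_from_top (f := fun a : ℕ =>
        ((a.descFactorial (Nat.card {l // c l = i}) : ℕ) : ℝ≥0∞))).comp
          (measurable_count (hb R i).1 (hb R i).2)
    · filter_upwards [h.ae_isFinite] with θ hθ R R' hRR'
      refine Finset.prod_le_prod' fun i _ => ?_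
      exact_mod_cast Nat.descFactorial_le _ (hθ.count_mono (Set.inter_subset_inter_right _
        (Metric.ball_subset_ball (by exact_mod_cast hRR'))))
    · filter_upwards [h.ae_isFinite] with θ hθ
      have hev : ∀ᶠ R : ℕ in atTop, ∀ i, θ.count (A i ∩ Metric.ball o R) = θ.count (A i) :=
        eventually_all.2 fun i => hθ.eventually_count_inter_ball (A i) o
      refine tendsto_const_nhds.congr' ?_
      filter_upwards [hev] with R hR
      simp [hR]
  refine tendsto_nhds_unique hleft (hright.congr fun R => (hR R).symm)

/-- The factorial moment measures have the correlation functions as densities. -/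
theorem bind_factorialMeasure (h : HasDominatedCorrelations ν μ ρ D) (n : ℕ) :
    μ.bind (factorialMeasure n) =
      (Measure.pi fun _ => ν).withDensity fun x => ENNReal.ofReal (ρ n x) := by
  have hcell : ∀ C ∈ cells S n, (Measure.pi fun _ => ν).withDensity
      (fun x => ENNReal.ofReal (ρ n x)) C = μ.bind (factorialMeasure n) C := by
    rintro _ ⟨m, A, c, hA, hAd, rfl⟩
    rw [withDensity_apply _ (measurableSet_cell hA c), h.lintegral_cell hA hAd c,
      Measure.bind_apply (measurableSet_cell hA c) (measurable_factorialMeasure n).aemeasurable]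
    refine lintegral_congr_ae ?_
    filter_upwards [h.ae_isFinite] with θ hθ
    exact (factorialMeasure_cell hθ hA hAd c).symm
  have : IsFiniteMeasure ((Measure.pi fun _ => ν).withDensity
      fun x : Fin n → S => ENNReal.ofReal (ρ n x)) :=
    isFiniteMeasure_withDensity (h.lintegral_lt_top n).ne
  exact (ext_of_generate_finite _ (generateFrom_cells n) (isPiSystem_cells n) hcell
    (hcell _ (univ_mem_cells n))).symm

theorem lintegral_factorialMeasure_castAdd (h : HasDominatedCorrelations ν μ ρ D) (n j : ℕ)
    {B : Set (Fin n → S)} (hB : MeasurableSet B) :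
    ∫⁻ θ, factorialMeasure (n + j) θ ((fun z i => z (Fin.castAdd j i)) ⁻¹' B) ∂μ =
      ENNReal.ofReal (∫ x in B, marginal ν ρ n j x ∂(Measure.pi fun _ => ν)) := by
  have hm : Measurable fun (z : Fin (n + j) → S) (i : Fin n) => z (Fin.castAdd j i) := by fun_prop
  have hB' := hm hB
  rw [← Measure.bind_apply hB' (measurable_factorialMeasure _).aemeasurable,
    h.bind_factorialMeasure, withDensity_apply _ hB',
    ← ofReal_integral_eq_lintegral_ofReal (h.integrable _).integrableOn
      (ae_of_all _ (h.isCorrelationFunction _).nonneg)]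
  congr 1
  have hmp : MeasurePreserving (fun p : (Fin n → S) × (Fin j → S) => Fin.append p.1 p.2)
      ((Measure.pi fun _ => ν).prod (Measure.pi fun _ => ν)) (Measure.pi fun _ => ν) :=
    ⟨measurable_finAppend n j, map_finAppend_prod_pi ν n j⟩
  have hpre : (fun p : (Fin n → S) × (Fin j → S) => Fin.append p.1 p.2) ⁻¹'
      ((fun z i => z (Fin.castAdd j i)) ⁻¹' B) = B ×ˢ Set.univ := by
    ext p
    simp
  have hint : Integrable (fun p : (Fin n → S) × (Fin j → S) => ρ (n + j) (Fin.append p.1 p.2))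
      ((Measure.pi fun _ => ν).prod (Measure.pi fun _ => ν)) :=
    hmp.integrable_comp_of_integrable (h.integrable _)
  rw [← hmp.map_eq, setIntegral_map hB' (by
      exact (h.isCorrelationFunction _).measurable.aestronglyMeasurable) hmp.measurable.aemeasurable,
    hpre, setIntegral_prod _ hint.integrableOn]
  simp [marginal]

/-- Integrating the inclusion and exclusion formula termwise gives the Janossy measure. -/
theorem janossyMeasure_apply (h : HasDominatedCorrelations ν μ ρ D) (n : ℕ)
    {B : Set (Fin n → S)} (hB : MeasurableSet B) :
    janossyMeasure μ n B ≠ ⊤ ∧ (janossyMeasure μ n B).toReal =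
      ∫ x in B, janossy ν ρ n x ∂(Measure.pi fun _ => ν) := by
  set P := Measure.pi fun _ : Fin n => ν
  set I := ∫ x, D x ∂ν
  have hI : 0 ≤ I := h.integral_nonneg
  let G : ℕ → Configuration S → ℝ := fun j θ =>
    (factorialMeasure (n + j) θ ((fun z i => z (Fin.castAdd j i)) ⁻¹' B)).toReal
  have hm : ∀ j, Measurable fun (z : Fin (n + j) → S) (i : Fin n) => z (Fin.castAdd j i) :=
    fun j => by fun_prop
  have hκm : ∀ j, Measurable fun θ : Configuration S =>
      factorialMeasure (n + j) θ ((fun z i => z (Fin.castAdd j i)) ⁻¹' B) := fun j =>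
    (Measure.measurable_coe (hm j hB)).comp (measurable_factorialMeasure _)
  have hGi : ∀ j, Integrable (G j) μ := fun j =>
    integrable_toReal_of_lintegral_ne_top (hκm j).aemeasurable (by
      rw [h.lintegral_factorialMeasure_castAdd n j hB]; exact ENNReal.ofReal_ne_top)
  have hmarg0 : ∀ j, 0 ≤ ∫ x in B, marginal ν ρ n j x ∂P := fun j =>
    MeasureTheory.integral_nonneg fun x => MeasureTheory.integral_nonneg fun y =>
      (h.isCorrelationFunction _).nonneg _
  have hGint : ∀ j, ∫ θ, G j θ ∂μ = ∫ x in B, marginal ν ρ n j x ∂P := fun j => by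
    rw [integral_toReal (hκm j).aemeasurable (ae_of_all _ fun θ => measure_lt_top _ _),
      h.lintegral_factorialMeasure_castAdd n j hB, ENNReal.toReal_ofReal (hmarg0 j)]
  have hprodB : ∫ x in B, ∏ i, D (x i) ∂P ≤ I ^ n := by
    rw [← integral_pi_prod_eq_pow D n]
    exact setIntegral_le_integral (h.integrable_prod n) (ae_of_all _ h.prod_nonneg)
  have hMm : ∀ j, AEStronglyMeasurable (marginal ν ρ n j) P := fun j => by
    have h1 : StronglyMeasurable (Function.uncurry fun (x : Fin n → S) (y : Fin j → S) =>
        ρ (n + j) (Fin.append x y)) :=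
      ((h.isCorrelationFunction _).measurable.comp (measurable_finAppend n j)).stronglyMeasurable
    exact h1.integral_prod_right.aestronglyMeasurable
  have hMi : ∀ j, Integrable (marginal ν ρ n j) P := fun j =>
    ((h.integrable_prod n).mul_const (I ^ j)).mono' (hMm j)
      (ae_of_all _ fun x => h.norm_marginal_le n j x)
  have hMle : ∀ j, ∫ x in B, ‖marginal ν ρ n j x‖ ∂P ≤ I ^ n * I ^ j := fun j => by
    calc ∫ x in B, ‖marginal ν ρ n j x‖ ∂P ≤ ∫ x in B, (∏ i, D (x i)) * I ^ j ∂P :=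
          integral_mono (hMi j).norm.integrableOn ((h.integrable_prod n).mul_const _).integrableOn
            fun x => h.norm_marginal_le n j x
      _ = (∫ x in B, ∏ i, D (x i) ∂P) * I ^ j := integral_mul_const _ _
      _ ≤ I ^ n * I ^ j := by gcongr
  have hnorm : ∀ j : ℕ, ‖(-1 : ℝ) ^ j / j.factorial‖ = 1 / j.factorial := fun j => by
    rw [norm_div, norm_pow, norm_neg, norm_one, one_pow, Real.norm_natCast]
  have hsum : Summable fun j : ℕ => I ^ n * (I ^ j / j.factorial) :=
    (Real.summable_pow_div_factorial I).mul_left _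
  -- both sides are sums of the same absolutely convergent series
  have hS1 := hasSum_integral_of_summable_integral_norm (μ := μ)
    (F := fun (j : ℕ) θ => (-1) ^ j / j.factorial * G j θ) (fun j => (hGi j).const_mul _) (by
      refine Summable.of_nonneg_of_le (fun j => MeasureTheory.integral_nonneg fun _ => norm_nonneg _)
        (fun j => ?_) hsum
      simp only [norm_mul, hnorm]
      rw [integral_const_mul]
      have h1 : ∫ θ, ‖G j θ‖ ∂μ = ∫ x in B, marginal ν ρ n j x ∂P := by
        rw [← hGint j]
        exact integral_congr_ae (ae_of_all _ fun θ => Real.norm_of_nonneg ENNReal.toReal_nonneg)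
      have h2 : ∫ x in B, marginal ν ρ n j x ∂P ≤ I ^ n * I ^ j :=
        (le_abs_self _).trans ((norm_integral_le_integral_norm _).trans (hMle j))
      rw [h1]
      calc 1 / (j.factorial : ℝ) * ∫ x in B, marginal ν ρ n j x ∂P
          ≤ 1 / (j.factorial : ℝ) * (I ^ n * I ^ j) := by gcongr
        _ = _ := by ring)
  have hS2 := hasSum_integral_of_summable_integral_norm (μ := P.restrict B)
    (F := fun (j : ℕ) x => (-1) ^ j / j.factorial * marginal ν ρ n j x)
    (fun j => ((hMi j).const_mul _).integrableOn) (by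
      refine Summable.of_nonneg_of_le (fun j => MeasureTheory.integral_nonneg fun _ => norm_nonneg _)
        (fun j => ?_) hsum
      simp only [norm_mul, hnorm]
      rw [integral_const_mul]
      calc 1 / (j.factorial : ℝ) * ∫ x in B, ‖marginal ν ρ n j x‖ ∂P
          ≤ 1 / (j.factorial : ℝ) * (I ^ n * I ^ j) := by gcongr; exact hMle j
        _ = _ := by ring)
  simp only [integral_const_mul, hGint] at hS1 hS2
  have heq := hS1.unique hS2
  have hpt : ∀ᵐ θ ∂μ, ∑' j : ℕ, (-1) ^ j / (j.factorial : ℝ) * G j θ =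
      (withPoints S n).indicator (fun θ => (factorialMeasure n θ B).toReal) θ := by
    filter_upwards [h.ae_isFinite] with θ hθ
    have h1 : ∀ j, G j θ =
        (factorialMeasure n θ B).toReal * ((θ.count Set.univ - n).descFactorial j : ℝ) := fun j => by
      simp only [G]
      rw [factorialMeasure_castAdd j hθ hB, ENNReal.toReal_mul, ENNReal.toReal_natCast]
    simp only [h1, mul_left_comm _ (factorialMeasure n θ B).toReal]
    rw [tsum_mul_left, tsum_alternating_descFactorial]
    rcases lt_trichotomy (θ.count Set.univ) n with hlt | heq | hgt
    · have h2 : factorialMeasure n θ B = 0 := by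
        apply measure_mono_null (Set.subset_univ B)
        rw [factorialMeasure_univ hθ, Nat.descFactorial_of_lt hlt, Nat.cast_zero]
      simp [Set.indicator, h2]
    · rw [Set.indicator_of_mem (show θ ∈ withPoints S n from ⟨hθ, heq⟩)]
      simp [heq]
    · rw [Set.indicator_of_notMem (fun h => hgt.ne' h.2), if_neg (by omega), mul_zero]
  have hκB : Measurable fun θ : Configuration S => factorialMeasure n θ B :=
    (Measure.measurable_coe hB).comp (measurable_factorialMeasure _)
  have hJ : janossyMeasure μ n B = ∫⁻ θ in withPoints S n, factorialMeasure n θ B ∂μ :=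
    Measure.bind_apply hB (measurable_factorialMeasure n).aemeasurable
  have hfin : janossyMeasure μ n B ≠ ⊤ := by
    rw [hJ]
    refine ((setLIntegral_le_lintegral _ _).trans_lt ?_).ne
    have h0 := h.lintegral_factorialMeasure_castAdd n 0 hB
    exact lt_of_eq_of_lt h0 ENNReal.ofReal_lt_top
  rw [integral_congr_ae hpt, integral_indicator (measurableSet_withPoints n),
    integral_toReal hκB.aemeasurable (ae_of_all _ fun θ => measure_lt_top _ _), ← hJ] at heq
  exact ⟨hfin, heq⟩

omit [Nonempty S] in
theorem integrable_janossy [SecondCountableTopology S]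
    (h : HasDominatedCorrelations ν μ ρ D) (n : ℕ) :
    Integrable (janossy ν ρ n) (Measure.pi fun _ => ν) :=
  ((h.integrable_prod n).mul_const _).mono'
    (h.continuous_janossy n).aestronglyMeasurable (ae_of_all _ (h.norm_janossy_le n))

/-- The restriction of `μ` to the configurations with `n` particles has, in terms of the positions
of the particles, the continuous density `janossy ν ρ n`. -/
theorem janossyMeasure_eq_withDensity [SecondCountableTopology S]
    (h : HasDominatedCorrelations ν μ ρ D) (n : ℕ) :
    janossyMeasure μ n =
      (Measure.pi fun _ => ν).withDensity fun x => ENNReal.ofReal (janossy ν ρ n x) := by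
  have hint := h.integrable_janossy n
  have hnn : 0 ≤ᵐ[Measure.pi fun _ => ν] janossy ν ρ n := by
    refine ae_nonneg_of_forall_setIntegral_nonneg hint fun B hB _ => ?_
    rw [← (h.janossyMeasure_apply n hB).2]
    exact ENNReal.toReal_nonneg
  ext B hB
  rw [withDensity_apply _ hB, ← ENNReal.ofReal_toReal (h.janossyMeasure_apply n hB).1,
    (h.janossyMeasure_apply n hB).2,
    ofReal_integral_eq_lintegral_ofReal hint.integrableOn (ae_restrict_of_ae hnn)]

end HasDominatedCorrelations

end Janossy

/-! ### Closability of directional derivatives -/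

section Closability

variable {X : Type*} [NormedAddCommGroup X] [NormedSpace ℝ X] [FiniteDimensional ℝ X]
  [MeasurableSpace X] [BorelSpace X] {m : Measure X} [m.IsAddHaarMeasure]

omit [NormedSpace ℝ X] [FiniteDimensional ℝ X] [BorelSpace X] [m.IsAddHaarMeasure] in
theorem integrable_mul_of_tsupport_subset [OpensMeasurableSpace X] [IsFiniteMeasureOnCompacts m]
    {φ h : X → ℝ} (hφ : Continuous φ)
    (hc : HasCompactSupport φ) (hh : ContinuousOn h (tsupport φ)) :
    Integrable (fun x => φ x * h x) m := by
  have hon : IntegrableOn (fun x => φ x * h x) (tsupport φ) m :=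
    (hφ.continuousOn.mul hh).integrableOn_compact' hc (isClosed_tsupport φ).measurableSet
  refine (integrableOn_iff_integrable_of_support_subset ?_).1 hon
  exact (Function.support_mul_subset_left _ _).trans (subset_tsupport φ)

/-- Integration by parts against a test function supported where the other function is smooth. -/
theorem integral_mul_fderiv_of_tsupport_subset {W : Set X} (hW : IsOpen W) {v φ : X → ℝ}
    (hv : ContDiffOn ℝ ∞ v W) (hφ : ContDiff ℝ ∞ φ) (hc : HasCompactSupport φ)
    (hsub : tsupport φ ⊆ W) (e : X) :
    ∫ x, φ x * fderiv ℝ v x e ∂m = -∫ x, fderiv ℝ φ x e * v x ∂m := by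
  have hφ' : Continuous fun x => fderiv ℝ φ x e :=
    (hφ.continuous_fderiv (by simp)).clm_apply continuous_const
  have hv' : ContinuousOn (fun x => fderiv ℝ v x e) W :=
    (hv.continuousOn_fderiv_of_isOpen hW (by simp)).clm_apply continuousOn_const
  have hts : tsupport (fun x => fderiv ℝ φ x e) ⊆ tsupport φ := tsupport_fderiv_apply_subset ℝ e
  have hc' : HasCompactSupport fun x => fderiv ℝ φ x e := hc.fderiv_apply ℝ e
  refine integral_mul_fderiv_eq_neg_fderiv_mul_of_integrable ?_ ?_ ?_ ?_ ?_
  · exact integrable_mul_of_tsupport_subset hφ' hc' (hv.continuousOn.mono (hts.trans hsub))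
  · exact integrable_mul_of_tsupport_subset hφ.continuous hc (hv'.mono hsub)
  · exact integrable_mul_of_tsupport_subset hφ.continuous hc (hv.continuousOn.mono hsub)
  · exact fun x _ => hφ.differentiable (by simp) x
  · exact fun x hx => (hv.contDiffAt (hW.mem_nhds (hsub hx))).differentiableAt (by simp)

omit [NormedSpace ℝ X] [FiniteDimensional ℝ X] [m.IsAddHaarMeasure] in
/-- On compact sets on which the continuous density `s` is positive, the reference measure is
dominated by a multiple of the measure with density `s`. -/
theorem exists_restrict_le_smul_withDensity {W C : Set X} {s : X → ℝ} (hs : ContinuousOn s W)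
    (hC : IsCompact C) (hCW : C ⊆ W) (hpos : ∀ x ∈ C, 0 < s x) :
    ∃ c : ℝ≥0∞, c ≠ ⊤ ∧
      m.restrict C ≤ c • (m.restrict W).withDensity fun x => ENNReal.ofReal (s x) := by
  rcases C.eq_empty_or_nonempty with rfl | hne
  · exact ⟨0, by simp, by simp⟩
  obtain ⟨x₀, hx₀, hmin⟩ := hC.exists_isMinOn hne (hs.mono hCW)
  have hc0 : ENNReal.ofReal (s x₀) ≠ 0 := (ENNReal.ofReal_pos.2 (hpos x₀ hx₀)).ne'
  refine ⟨(ENNReal.ofReal (s x₀))⁻¹, ENNReal.inv_ne_top.2 hc0, Measure.le_iff.2 fun A hA => ?_⟩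
  rw [Measure.smul_apply, smul_eq_mul, withDensity_apply _ hA, mul_comm,
    ← div_eq_mul_inv, ENNReal.le_div_iff_mul_le (Or.inl hc0) (Or.inl ENNReal.ofReal_ne_top), mul_comm]
  calc ENNReal.ofReal (s x₀) * m.restrict C A
      = ∫⁻ _ in A, ENNReal.ofReal (s x₀) ∂(m.restrict C) := by rw [setLIntegral_const]
    _ ≤ ∫⁻ x in A, ENNReal.ofReal (s x) ∂(m.restrict C) := by
        refine lintegral_mono_ae (ae_restrict_of_ae ?_)
        filter_upwards [ae_restrict_mem hC.measurableSet] with x hx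
        exact ENNReal.ofReal_le_ofReal (hmin hx)
    _ ≤ ∫⁻ x in A, ENNReal.ofReal (s x) ∂(m.restrict W) :=
        lintegral_mono' (Measure.restrict_mono le_rfl (Measure.restrict_mono hCW le_rfl)) le_rfl

/-- The derivative in a fixed direction is closable in `L²` of a measure with continuous density
`s` on an open set `W`: on the open set where `s` is positive, an `L²` limit of derivatives of a
null sequence vanishes in the sense of distributions. -/
theorem tendsto_eLpNorm_fderiv_zero {W : Set X} (hW : IsOpen W) {s : X → ℝ} (hsm : Measurable s)
    (hs : ContinuousOn s W) {v : ℕ → X → ℝ} (hv : ∀ n, ContDiffOn ℝ ∞ (v n) W) (e : X)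
    {ν : Measure X} (hν : ν = (m.restrict W).withDensity fun x => ENNReal.ofReal (s x))
    (h0 : Tendsto (fun n => eLpNorm (v n) 2 ν) atTop (𝓝 0))
    (hmem : ∀ n, MemLp (fun x => fderiv ℝ (v n) x e) 2 ν)
    (hcau : Tendsto (fun p : ℕ × ℕ => eLpNorm (fun x => fderiv ℝ (v p.1) x e -
      fderiv ℝ (v p.2) x e) 2 ν) atTop (𝓝 0)) :
    Tendsto (fun n => eLpNorm (fun x => fderiv ℝ (v n) x e) 2 ν) atTop (𝓝 0) := by
  set g : ℕ → X → ℝ := fun n x => fderiv ℝ (v n) x e with hg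
  have hgc : ∀ n, ContinuousOn (g n) W := fun n =>
    ((hv n).continuousOn_fderiv_of_isOpen hW (by simp)).clm_apply continuousOn_const
  have hcauchy : CauchySeq fun n => (hmem n).toLp (g n) := by
    rw [Lp.cauchySeq_Lp_iff_cauchySeq_eLpNorm]
    refine hcau.congr fun p => eLpNorm_congr_ae ?_
    filter_upwards [(hmem p.1).coeFn_toLp, (hmem p.2).coeFn_toLp] with x h1 h2
    rw [Pi.sub_apply, h1, h2]
  obtain ⟨F, hF⟩ := cauchySeq_tendsto_of_complete hcauchy
  set V : X → ℝ := ⇑F with hV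
  have hVmem : MemLp V 2 ν := Lp.memLp F
  have hlim : Tendsto (fun n => eLpNorm (g n - V) 2 ν) atTop (𝓝 0) := by
    rw [Lp.tendsto_Lp_iff_tendsto_eLpNorm'] at hF
    refine hF.congr fun n => eLpNorm_congr_ae ?_
    filter_upwards [(hmem n).coeFn_toLp] with x h1
    rw [Pi.sub_apply, Pi.sub_apply, h1]
  set Ω : Set X := W ∩ s ⁻¹' Set.Ioi 0 with hΩ
  have hΩo : IsOpen Ω := hs.isOpen_inter_preimage hW isOpen_Ioi
  have hdom : ∀ C : Set X, IsCompact C → C ⊆ Ω → ∃ c : ℝ≥0∞, c ≠ ⊤ ∧ m.restrict C ≤ c • ν := by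
    intro C hC hCΩ
    rw [hν]
    exact exists_restrict_le_smul_withDensity hs hC (fun x hx => (hCΩ hx).1)
      fun x hx => (hCΩ hx).2
  have hVC : ∀ C : Set X, IsCompact C → C ⊆ Ω → IntegrableOn V C m := by
    intro C hC hCΩ
    obtain ⟨c, hc, hle⟩ := hdom C hC hCΩ
    have : IsFiniteMeasure (m.restrict C) :=
      ⟨by rw [Measure.restrict_apply_univ]; exact hC.measure_lt_top⟩
    exact (hVmem.of_measure_le_smul hc hle).integrable (by norm_num)
  -- convergence in `L²(ν)` implies convergence of integrals against test functions
  have hweak : ∀ (C : Set X), IsCompact C → C ⊆ Ω → ∀ ψ : X → ℝ, Continuous ψ →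
      Function.support ψ ⊆ C → ∀ w : ℕ → X → ℝ, (∀ n, AEStronglyMeasurable (w n) (m.restrict C)) →
      Tendsto (fun n => eLpNorm (w n) 2 ν) atTop (𝓝 0) →
      Tendsto (fun n => ∫ x, ψ x * w n x ∂m) atTop (𝓝 0) := by
    intro C hC hCΩ ψ hψ hψC w hwm hw
    obtain ⟨c, hc, hle⟩ := hdom C hC hCΩ
    obtain ⟨M, hM⟩ := (hC.image hψ).isBounded.exists_norm_le
    have hfin : m.restrict C Set.univ ≠ ⊤ := by
      rw [Measure.restrict_apply_univ]; exact hC.measure_lt_top.ne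
    set κ : ℝ≥0∞ := ENNReal.ofReal M * (c ^ (1 / (2 : ℝ≥0∞)).toReal *
      m.restrict C Set.univ ^ (1 / (1 : ℝ≥0∞).toReal - 1 / (2 : ℝ≥0∞).toReal)) with hκ
    have hκt : κ ≠ ⊤ := by
      refine ENNReal.mul_ne_top ENNReal.ofReal_ne_top (ENNReal.mul_ne_top ?_ ?_)
      · exact ENNReal.rpow_ne_top_of_nonneg ENNReal.toReal_nonneg hc
      · exact ENNReal.rpow_ne_top_of_nonneg (by norm_num) hfin
    have hbound : ∀ n, ‖∫ x, ψ x * w n x ∂m‖ₑ ≤ κ * eLpNorm (w n) 2 ν := by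
      intro n
      have h1 : ∫ x, ψ x * w n x ∂m = ∫ x in C, ψ x * w n x ∂m := by
        symm
        apply setIntegral_eq_integral_of_forall_compl_eq_zero
        intro x hx
        rw [Function.notMem_support.1 fun h => hx (hψC h), zero_mul]
      rw [h1]
      calc ‖∫ x in C, ψ x * w n x ∂m‖ₑ ≤ ∫⁻ x in C, ‖ψ x * w n x‖ₑ ∂m :=
            enorm_integral_le_lintegral_enorm _
        _ ≤ ∫⁻ x in C, ENNReal.ofReal M * ‖w n x‖ₑ ∂m := by
            refine setLIntegral_mono_ae' hC.measurableSet (ae_of_all _ fun x hx => ?_)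
            rw [enorm_mul]
            gcongr
            rw [← ofReal_norm]
            exact ENNReal.ofReal_le_ofReal (hM _ ⟨x, hx, rfl⟩)
        _ = ENNReal.ofReal M * eLpNorm (w n) 1 (m.restrict C) := by
            rw [lintegral_const_mul' _ _ ENNReal.ofReal_ne_top, eLpNorm_one_eq_lintegral_enorm]
        _ ≤ ENNReal.ofReal M * (eLpNorm (w n) 2 (m.restrict C) *
              m.restrict C Set.univ ^ (1 / (1 : ℝ≥0∞).toReal - 1 / (2 : ℝ≥0∞).toReal)) := by
            gcongr
            exact eLpNorm_le_eLpNorm_mul_rpow_measure_univ (by norm_num) (hwm n)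
        _ ≤ ENNReal.ofReal M * ((c ^ (1 / (2 : ℝ≥0∞)).toReal * eLpNorm (w n) 2 ν) *
              m.restrict C Set.univ ^ (1 / (1 : ℝ≥0∞).toReal - 1 / (2 : ℝ≥0∞).toReal)) := by
            gcongr
            refine (eLpNorm_mono_measure _ hle).trans ?_
            rw [eLpNorm_smul_measure_of_ne_top (by norm_num), smul_eq_mul]
        _ = κ * eLpNorm (w n) 2 ν := by rw [hκ]; ring
    rw [tendsto_zero_iff_enorm_tendsto_zero]
    have h2 : Tendsto (fun n => κ * eLpNorm (w n) 2 ν) atTop (𝓝 0) := by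
      have := ENNReal.Tendsto.const_mul (a := κ) hw (Or.inr hκt)
      rwa [mul_zero] at this
    exact tendsto_of_tendsto_of_tendsto_of_le_of_le tendsto_const_nhds h2 (fun _ => bot_le)
      hbound
  have hVzero : ∀ᵐ x ∂m, x ∈ Ω → V x = 0 := by
    refine hΩo.ae_eq_zero_of_integral_contDiff_smul_eq_zero ?_ fun φ hφ hφc hφs => ?_
    · exact (locallyIntegrableOn_iff hΩo.isLocallyClosed).2 fun C hCΩ hC => hVC C hC hCΩ
    · have hφc' : IsCompact (tsupport φ) := hφc
      have hW' : tsupport φ ⊆ W := fun x hx => (hφs hx).1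
      have hts : Function.support (fun x => fderiv ℝ φ x e) ⊆ tsupport φ :=
        (subset_tsupport _).trans (tsupport_fderiv_apply_subset ℝ e)
      have hmeasV : AEStronglyMeasurable V (m.restrict (tsupport φ)) :=
        (hVC _ hφc' hφs).aestronglyMeasurable
      have hmeasC : ∀ h : X → ℝ, ContinuousOn h W →
          AEStronglyMeasurable h (m.restrict (tsupport φ)) := fun h hh =>
        (hh.mono hW').aestronglyMeasurable_of_isCompact hφc' hφc'.measurableSet
      have h1 := hweak _ hφc' hφs φ hφ.continuous (subset_tsupport φ) (fun n => g n - V)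
        (fun n => (hmeasC _ (hgc n)).sub hmeasV) hlim
      have h2 := hweak _ hφc' hφs (fun x => fderiv ℝ φ x e)
        ((hφ.continuous_fderiv (by simp)).clm_apply continuous_const) hts v
        (fun n => hmeasC _ (hv n).continuousOn) h0
      have hVint : Integrable (fun x => φ x * V x) m := by
        have hon : IntegrableOn (fun x => φ x * V x) (tsupport φ) m :=
          (hVC _ hφc' hφs).continuousOn_mul hφ.continuous.continuousOn hφc'
        refine (integrableOn_iff_integrable_of_support_subset ?_).1 hon
        exact (Function.support_mul_subset_left _ _).trans (subset_tsupport φ)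
      have h3 : ∀ n, ∫ x, φ x * (g n - V) x ∂m =
          -(∫ x, fderiv ℝ φ x e * v n x ∂m) - ∫ x, φ x * V x ∂m := by
        intro n
        rw [← integral_mul_fderiv_of_tsupport_subset hW (hv n) hφ hφc hW' e,
          ← integral_sub (integrable_mul_of_tsupport_subset hφ.continuous hφc ((hgc n).mono hW'))
            hVint]
        refine integral_congr_ae (ae_of_all _ fun x => ?_)
        simp only [Pi.sub_apply, hg]
        ring
      simp only [h3] at h1
      have h4 := tendsto_nhds_unique h1 (h2.neg.sub_const (∫ x, φ x * V x ∂m))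
      simp only [smul_eq_mul]
      linarith
  have hVν : V =ᵐ[ν] 0 := by
    rw [hν, EventuallyEq, ae_withDensity_iff hsm.ennreal_ofReal, ae_restrict_iff' hW.measurableSet]
    filter_upwards [hVzero] with x hx hxW hxs
    exact hx ⟨hxW, by simpa using hxs⟩
  refine hlim.congr fun n => eLpNorm_congr_ae ?_
  filter_upwards [hVν] with x hx
  simp [hx, hg]

end Closability

/-! ### The square field in coordinates -/

section Sites

variable {S : Type*} [PseudoMetricSpace S]

theorem finsum_mult_ofPoints {n : ℕ} (x : Fin n → S) (F : S → ℝ) :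
    ∑ᶠ y, ((ofPoints x).mult y : ℝ) * F y = ∑ i, F (x i) := by
  classical
  rw [Finset.sum_comp F x, finsum_eq_sum_of_support_subset (s := Finset.univ.image x)]
  · refine Finset.sum_congr rfl fun y _ => ?_
    rw [mult_ofPoints, Nat.card_eq_fintype_card, Fintype.card_subtype, nsmul_eq_mul]
  · intro y hy
    have : (ofPoints x).mult y ≠ 0 := fun h => hy (by simp [h])
    simpa using mult_ofPoints_ne_zero.1 this

/-- Taking out the `i`-th particle and putting it back at `z` moves it to `z`. -/
theorem addPoints_erase_ofPoints [DecidableEq S] {n : ℕ} (x : Fin n → S) (i : Fin n) (z : S) :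
    ((ofPoints x).erase (x i)).addPoints (fun _ : Fin 1 => z) =
      ofPoints (Function.update x i z) := by
  have hcard : ∀ (w : Fin n → S) (y : S), Nat.card {l // w l = y} =
      (if w i = y then 1 else 0) + ∑ l ∈ Finset.univ.erase i, if w l = y then 1 else 0 := by
    intro w y
    rw [Nat.card_eq_fintype_card, Fintype.card_subtype, Finset.card_filter,
      Finset.add_sum_erase _ (fun l => if w l = y then 1 else 0) (Finset.mem_univ i)]
  ext y
  have h1 : Nat.card {_l : Fin 1 // z = y} = if z = y then 1 else 0 := by
    by_cases h : z = y <;> simp [h]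
  have h2 : ∑ l ∈ Finset.univ.erase i, (if Function.update x i z l = y then 1 else 0) =
      ∑ l ∈ Finset.univ.erase i, if x l = y then 1 else 0 :=
    Finset.sum_congr rfl fun l hl => by rw [Function.update_of_ne (Finset.ne_of_mem_erase hl)]
  rw [mult_ofPoints, hcard, h2, Function.update_self]
  simp only [addPoints, erase, h1]
  rw [mult_ofPoints, hcard]
  by_cases hy : y = x i
  · subst hy
    simp [add_comm]
  · rw [if_neg hy, if_neg (Ne.symm hy), zero_add, add_comm]

end Sites

section Coordinates

variable {d : ℕ} {E : Set (EuclideanSpace ℝ (Fin d))}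

/-- The inclusion of `Eⁿ` into `(ℝᵈ)ⁿ`. -/
def coordVal {n : ℕ} (x : Fin n → E) : Fin n → EuclideanSpace ℝ (Fin d) := fun i => x i

/-- The direction in `(ℝᵈ)ⁿ` in which the `j`-th coordinate of the `i`-th particle moves. -/
def direction (d n : ℕ) (p : Fin n × Fin d) : Fin n → EuclideanSpace ℝ (Fin d) :=
  Pi.single p.1 (EuclideanSpace.single p.2 1)

/-- The positions of `n` particles in the interior of `E`. -/
def interiorPoints (E : Set (EuclideanSpace ℝ (Fin d))) (n : ℕ) :
    Set (Fin n → EuclideanSpace ℝ (Fin d)) := Set.univ.pi fun _ => interior E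

theorem isOpen_interiorPoints (E : Set (EuclideanSpace ℝ (Fin d))) (n : ℕ) :
    IsOpen (interiorPoints E n) :=
  isOpen_set_pi Set.finite_univ fun _ _ => isOpen_interior

/-- The derivative of `f` in the `j`-th coordinate of the position of the `i`-th of `n` particles. -/
def partialDeriv (f : Configuration E → ℝ) (n : ℕ) (p : Fin n × Fin d)
    (y : Fin n → EuclideanSpace ℝ (Fin d)) : ℝ :=
  fderiv ℝ (coordFun f empty n) y (direction d n p)

theorem coordFun_coordVal (f : Configuration E → ℝ) {n : ℕ} (x : Fin n → E) :
    coordFun f empty n (coordVal x) = f (ofPoints x) := by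
  have h : ∀ i, coordVal x i ∈ E := fun i => (x i).2
  rw [coordFun, dif_pos h]
  rfl

theorem IsSmooth.contDiffOn_interiorPoints {f : Configuration E → ℝ} (hf : IsSmooth f) (n : ℕ) :
    ContDiffOn ℝ ∞ (coordFun f empty n) (interiorPoints E n) :=
  (hf empty n).mono fun _ hy i => interior_subset (hy i (Set.mem_univ i))

theorem coordFun_sub (f g : Configuration E → ℝ) (η : Configuration E) (n : ℕ) :
    coordFun (f - g) η n = coordFun f η n - coordFun g η n := by
  ext y
  by_cases h : ∀ i, y i ∈ E <;> simp [coordFun, h]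

theorem IsSmooth.sub {f g : Configuration E → ℝ} (hf : IsSmooth f) (hg : IsSmooth g) :
    IsSmooth (f - g) := fun η n => by
  rw [coordFun_sub]
  exact (hf η n).sub (hg η n)

theorem partialDeriv_sub {f g : Configuration E → ℝ} (hf : IsSmooth f) (hg : IsSmooth g) {n : ℕ}
    (p : Fin n × Fin d) {y : Fin n → EuclideanSpace ℝ (Fin d)} (hy : y ∈ interiorPoints E n) :
    partialDeriv (f - g) n p y = partialDeriv f n p y - partialDeriv g n p y := by
  have hW := (isOpen_interiorPoints E n).mem_nhds hy
  have h1 := ((hf.contDiffOn_interiorPoints n).contDiffAt hW).differentiableAt (by simp)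
  have h2 := ((hg.contDiffOn_interiorPoints n).contDiffAt hW).differentiableAt (by simp)
  rw [partialDeriv, coordFun_sub, fderiv_sub h1 h2]
  rfl

theorem inner_gradientWithin_self {v : EuclideanSpace ℝ (Fin d) → ℝ}
    {s : Set (EuclideanSpace ℝ (Fin d))} {x : EuclideanSpace ℝ (Fin d)} (hs : s ∈ 𝓝 x) :
    inner ℝ (gradientWithin v s x) (gradientWithin v s x) =
      ∑ j, (fderiv ℝ v x (EuclideanSpace.single j 1)) ^ 2 := by
  rw [real_inner_self_eq_norm_sq, EuclideanSpace.real_norm_sq_eq]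
  refine Finset.sum_congr rfl fun j _ => ?_
  congr 1
  have h1 : inner ℝ (gradientWithin v s x) (EuclideanSpace.single j (1 : ℝ)) =
      fderiv ℝ v x (EuclideanSpace.single j 1) := by
    rw [gradientWithin, InnerProductSpace.toDual_symm_apply, fderivWithin_of_mem_nhds hs]
  rw [← h1, EuclideanSpace.inner_single_right]
  simp

theorem coordFun_erase_ofPoints (f : Configuration E → ℝ) {n : ℕ} (x : Fin n → E) (i : Fin n)
    (y : EuclideanSpace ℝ (Fin d)) :
    coordFun f ((ofPoints x).erase (x i)) 1 (fun _ => y) =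
      coordFun f empty n (Function.update (coordVal x) i y) := by
  classical
  by_cases hy : y ∈ E
  · have h1 : Function.update (coordVal x) i y = coordVal (Function.update x i ⟨y, hy⟩) := by
      ext1 l
      by_cases hl : l = i
      · subst hl; simp [coordVal]
      · simp [coordVal, hl]
    rw [h1, coordFun_coordVal, coordFun, dif_pos fun _ => hy, addPoints_erase_ofPoints]
  · rw [coordFun, dif_neg fun h => hy (h 0), coordFun, dif_neg fun h => hy (by simpa using h i)]

/-- The square field of `f` at a configuration of particles in the interior of `E`, in
coordinates. -/
theorem squareField_ofPoints {f : Configuration E → ℝ} (hf : IsSmooth f) {n : ℕ} {x : Fin n → E}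
    (hx : coordVal x ∈ interiorPoints E n) :
    squareField f f (ofPoints x) = (1 / 2) * ∑ p, partialDeriv f n p (coordVal x) ^ 2 := by
  rw [squareField, finsum_mult_ofPoints x fun y =>
    inner ℝ (particleGradient f (ofPoints x) y) (particleGradient f (ofPoints x) y),
    Fintype.sum_prod_type]
  congr 1
  refine Finset.sum_congr rfl fun i _ => ?_
  have hxi : E ∈ 𝓝 (x i : EuclideanSpace ℝ (Fin d)) :=
    mem_interior_iff_mem_nhds.1 (hx i (Set.mem_univ i))
  rw [particleGradient, inner_gradientWithin_self hxi]
  refine Finset.sum_congr rfl fun j _ => ?_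
  congr 1
  simp only [coordFun_erase_ofPoints]
  have h1 := ((hf.contDiffOn_interiorPoints n).contDiffAt
    ((isOpen_interiorPoints E n).mem_nhds hx)).differentiableAt (by simp)
  have h2 : HasFDerivAt (coordFun f empty n) (fderiv ℝ (coordFun f empty n) (coordVal x))
      (Function.update (coordVal x) i (x i : EuclideanSpace ℝ (Fin d))) := by
    rw [show (x i : EuclideanSpace ℝ (Fin d)) = coordVal x i from rfl, Function.update_eq_self]
    exact h1.hasFDerivAt
  have h3 := h2.comp (x i : EuclideanSpace ℝ (Fin d)) (hasFDerivAt_update (coordVal x) _)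
  rw [show (fun y => coordFun f empty n (Function.update (coordVal x) i y)) =
    coordFun f empty n ∘ Function.update (coordVal x) i from rfl, h3.fderiv]
  simp only [partialDeriv, direction, ContinuousLinearMap.comp_apply]
  congr 1
  ext1 l
  by_cases hl : l = i
  · subst hl; simp
  · simp [hl]

theorem squareField_self_nonneg (f : Configuration E → ℝ) (θ : Configuration E) :
    0 ≤ squareField f f θ := by
  refine mul_nonneg (by norm_num) (finsum_nonneg fun x => mul_nonneg (Nat.cast_nonneg _) ?_)
  exact real_inner_self_nonneg

theorem isClosedEmbedding_coordVal (hE : IsClosed E) (n : ℕ) :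
    IsClosedEmbedding (coordVal : (Fin n → E) → Fin n → EuclideanSpace ℝ (Fin d)) := by
  have hr : Set.range (coordVal : (Fin n → E) → Fin n → EuclideanSpace ℝ (Fin d)) =
      Set.univ.pi fun _ => E := by
    ext y
    simp only [Set.mem_range, Set.mem_pi, Set.mem_univ, true_imp_iff]
    constructor
    · rintro ⟨x, rfl⟩ i
      exact (x i).2
    · exact fun h => ⟨fun i => ⟨y i, h i⟩, rfl⟩
  refine ⟨⟨⟨?_⟩, fun x y h => funext fun i => Subtype.ext (congrFun h i)⟩, ?_⟩
  · exact (Topology.IsInducing.piMap fun _ : Fin n =>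
      (Topology.IsInducing.subtypeVal : IsInducing (Subtype.val : E → _))).eq_induced
  · rw [hr]
    exact isClosed_set_pi fun _ _ => hE

theorem sigmaFinite_lebesgue (hE : IsClosed E) : SigmaFinite (lebesgue E) := by
  have := ProperSpace.of_isClosed hE
  have := isFiniteMeasureOnCompacts_lebesgue hE
  infer_instance

/-- As the boundary of `E` is a null set, Lebesgue measure on `Eⁿ` may be regarded as Lebesgue
measure on the interior. -/
theorem map_coordVal_pi_lebesgue (hE : IsClosedSmoothDomain E) (n : ℕ) :
    (Measure.pi fun _ : Fin n => lebesgue E).map coordVal =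
      volume.restrict (interiorPoints E n) := by
  have := sigmaFinite_lebesgue hE.isClosed
  have hmp := measurePreserving_val_lebesgue hE.isClosed
  have h1 : (lebesgue E).map Subtype.val = volume.restrict (interior E) := by
    rw [hmp.map_eq]
    refine (Measure.restrict_congr_set ?_)
    refine (ae_eq_set.2 ⟨hE.volume_diff_interior, ?_⟩)
    rw [Set.sdiff_eq_empty.2 interior_subset]
    exact measure_empty
  have : SigmaFinite ((lebesgue E).map (Subtype.val : E → EuclideanSpace ℝ (Fin d))) := by
    rw [h1]; infer_instance
  have h2 := Measure.pi_map_pi (μ := fun _ : Fin n => lebesgue E)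
    (f := fun _ => (Subtype.val : E → EuclideanSpace ℝ (Fin d)))
    fun _ => measurable_subtype_coe.aemeasurable
  rw [show (coordVal : (Fin n → E) → Fin n → EuclideanSpace ℝ (Fin d)) =
    fun x i => (x i : EuclideanSpace ℝ (Fin d)) from rfl, h2, h1, interiorPoints,
    ← Measure.restrict_pi_pi]
  rfl

end Coordinates

/-! ### Closability of the form -/

section Energy

variable {d : ℕ} {E : Set (EuclideanSpace ℝ (Fin d))}

/-- The law of the ordered positions of the particles, on the event that there are `n` of them, as a
measure on `(ℝᵈ)ⁿ`. -/
def coordMeasure (μ : Measure (Configuration E)) (n : ℕ) :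
    Measure (Fin n → EuclideanSpace ℝ (Fin d)) := (janossyMeasure μ n).map coordVal

/-- The energy of `f` on the event that there are `n` particles. -/
def energyPart (μ : Measure (Configuration E)) (f : Configuration E → ℝ) (n : ℕ) : ℝ≥0∞ :=
  (n.factorial : ℝ≥0∞)⁻¹ * (2⁻¹ * ∑ p, eLpNorm (partialDeriv f n p) 2 (coordMeasure μ n) ^ 2)

theorem measurable_partialDeriv (f : Configuration E → ℝ) (n : ℕ) (p : Fin n × Fin d) :
    Measurable (partialDeriv f n p) := measurable_fderiv_apply_const ℝ _ _

/-- In the coordinates of the particles, the field has a density on `(int E)ⁿ` that is continuous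
there. -/
theorem HasDominatedCorrelations.coordMeasure_eq {μ : Measure (Configuration E)}
    {ρ : (n : ℕ) → (Fin n → E) → ℝ} {D : E → ℝ} (hE : IsClosedSmoothDomain E) [Nonempty E]
    (h : HasDominatedCorrelations (lebesgue E) μ ρ D) (n : ℕ) :
    ∃ s : (Fin n → EuclideanSpace ℝ (Fin d)) → ℝ, Measurable s ∧
      ContinuousOn s (interiorPoints E n) ∧ coordMeasure μ n =
        (volume.restrict (interiorPoints E n)).withDensity fun y => ENNReal.ofReal (s y) := by
  have := sigmaFinite_lebesgue hE.isClosed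
  have hce := isClosedEmbedding_coordVal hE.isClosed n
  have hme := hce.measurableEmbedding
  set s := Function.extend coordVal (janossy (lebesgue E) ρ n) 0 with hs
  have hsv : ∀ x, s (coordVal x) = janossy (lebesgue E) ρ n x := fun x =>
    hce.injective.extend_apply _ _ x
  have hsm : Measurable s := hme.measurable_extend (h.continuous_janossy n).measurable
    measurable_zero
  refine ⟨s, hsm, ?_, ?_⟩
  · rw [continuousOn_iff_continuous_domRestrict]
    have h1 : (interiorPoints E n).domRestrict s = janossy (lebesgue E) ρ n ∘
        fun y i => ⟨y.1 i, interior_subset (y.2 i (Set.mem_univ i))⟩ := by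
      ext y
      rw [Function.comp_apply, ← hsv]
      rfl
    rw [h1]
    exact (h.continuous_janossy n).comp (continuous_pi fun i =>
      ((continuous_apply i).comp continuous_subtype_val).subtype_mk _)
  · ext A hA
    rw [coordMeasure, hme.map_apply, h.janossyMeasure_eq_withDensity n,
      withDensity_apply _ (hme.measurable hA), withDensity_apply _ hA,
      ← map_coordVal_pi_lebesgue hE n, setLIntegral_map hA hsm.ennreal_ofReal hme.measurable]
    simp only [hsv]

theorem sq_eLpNorm_two {α : Type*} [MeasurableSpace α] (ν : Measure α) (f : α → ℝ) :
    eLpNorm f 2 ν ^ 2 = ∫⁻ x, ‖f x‖ₑ ^ 2 ∂ν := by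
  rw [eLpNorm_eq_lintegral_rpow_enorm_toReal (by norm_num) (by norm_num), ← ENNReal.rpow_natCast,
    ← ENNReal.rpow_mul]
  norm_num

theorem tendsto_zero_of_sq_tendsto_zero {ι : Type*} {l : Filter ι} {a : ι → ℝ≥0∞}
    (h : Tendsto (fun i => a i ^ 2) l (𝓝 0)) : Tendsto a l (𝓝 0) := by
  have h1 := (ENNReal.continuous_rpow_const (y := (1 / 2 : ℝ))).tendsto 0 |>.comp h
  rw [ENNReal.zero_rpow_of_pos (by norm_num)] at h1
  refine h1.congr fun i => ?_
  rw [Function.comp_apply, ← ENNReal.rpow_natCast, ← ENNReal.rpow_mul]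
  norm_num

variable {μ : Measure (Configuration E)} {ρ : (n : ℕ) → (Fin n → E) → ℝ} {D : E → ℝ}

theorem ae_coordMeasure_mem (hE : IsClosedSmoothDomain E) [Nonempty E]
    (h : HasDominatedCorrelations (lebesgue E) μ ρ D) (n : ℕ) :
    ∀ᵐ y ∂(coordMeasure μ n), y ∈ interiorPoints E n := by
  obtain ⟨s, -, -, hs⟩ := h.coordMeasure_eq hE n
  rw [hs]
  exact (withDensity_absolutelyContinuous _ _).ae_le
    (ae_restrict_mem (isOpen_interiorPoints E n).measurableSet)

theorem ae_janossyMeasure_mem (hE : IsClosedSmoothDomain E) [Nonempty E]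
    (h : HasDominatedCorrelations (lebesgue E) μ ρ D) (n : ℕ) :
    ∀ᵐ x ∂(janossyMeasure μ n), coordVal x ∈ interiorPoints E n :=
  (isClosedEmbedding_coordVal hE.isClosed n).measurableEmbedding.ae_map_iff.1
    (ae_coordMeasure_mem hE h n)

theorem aemeasurable_squareField (hE : IsClosedSmoothDomain E) [Nonempty E]
    (h : HasDominatedCorrelations (lebesgue E) μ ρ D) {f : Configuration E → ℝ} (hf : IsSmooth f) :
    AEMeasurable (fun θ => ENNReal.ofReal (squareField f f θ)) μ := by
  have := sigmaFinite_lebesgue hE.isClosed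
  refine aemeasurable_of_comp_ofPoints h.ae_isFinite fun n => ?_
  have hm : Measurable fun x : Fin n → E =>
      ENNReal.ofReal ((1 / 2) * ∑ p, partialDeriv f n p (coordVal x) ^ 2) := by
    refine ((Finset.measurable_sum _ fun p _ => ?_).const_mul _).ennreal_ofReal
    exact ((measurable_partialDeriv f n p).comp
      (isClosedEmbedding_coordVal hE.isClosed n).continuous.measurable).pow_const 2
  refine ⟨_, hm, ?_⟩
  filter_upwards [ae_janossyMeasure_mem hE h n] with x hx
  rw [squareField_ofPoints hf hx]

theorem lintegral_squareField (hE : IsClosedSmoothDomain E) [Nonempty E]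
    (h : HasDominatedCorrelations (lebesgue E) μ ρ D) {f : Configuration E → ℝ} (hf : IsSmooth f) :
    ∫⁻ θ, ENNReal.ofReal (squareField f f θ) ∂μ = ∑' n, energyPart μ f n := by
  have := sigmaFinite_lebesgue hE.isClosed
  rw [lintegral_eq_tsum_janossyMeasure h.ae_isFinite (aemeasurable_squareField hE h hf)]
  refine tsum_congr fun n => ?_
  have hme := (isClosedEmbedding_coordVal hE.isClosed n).measurableEmbedding
  have hm : ∀ p, Measurable fun x : Fin n → E => ‖partialDeriv f n p (coordVal x)‖ₑ ^ 2 := fun p =>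
    ((measurable_partialDeriv f n p).comp hme.measurable).enorm.pow_const 2
  rw [energyPart]
  congr 1
  simp only [sq_eLpNorm_two, coordMeasure, hme.lintegral_map]
  rw [← lintegral_finsetSum _ fun p _ => hm p, ← lintegral_const_mul _
    (Finset.measurable_sum _ fun p _ => hm p)]
  refine lintegral_congr_ae ?_
  filter_upwards [ae_janossyMeasure_mem hE h n] with x hx
  rw [squareField_ofPoints hf hx, ENNReal.ofReal_mul (by norm_num),
    ENNReal.ofReal_sum_of_nonneg fun _ _ => sq_nonneg _]
  congr 1
  · rw [one_div, ENNReal.ofReal_inv_of_pos (by norm_num)]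
    norm_num
  · refine Finset.sum_congr rfl fun p _ => ?_
    rw [← Real.enorm_of_nonneg (sq_nonneg _), enorm_pow]

/-- The energy is the sum of its parts. Outside the domain of the form both sides may be infinite,
in which case both the integral and `ENNReal.toReal` take the junk value zero. -/
theorem energy_eq (hE : IsClosedSmoothDomain E) [Nonempty E]
    (h : HasDominatedCorrelations (lebesgue E) μ ρ D) {f : Configuration E → ℝ} (hf : IsSmooth f) :
    energy μ f f = (∑' n, energyPart μ f n).toReal := by
  rw [← lintegral_squareField hE h hf, energy, integral_eq_lintegral_of_nonneg_ae
    (ae_of_all _ (squareField_self_nonneg f))]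
  have := (aemeasurable_squareField hE h hf).ennreal_toReal.aestronglyMeasurable
  refine this.congr (ae_of_all _ fun θ => ?_)
  exact ENNReal.toReal_ofReal (squareField_self_nonneg f θ)

theorem energyPart_le_of_forall_le {f g φ : Configuration E → ℝ} {n : ℕ}
    (h : ∀ p, eLpNorm (partialDeriv φ n p) 2 (coordMeasure μ n) ≤
      eLpNorm (partialDeriv f n p) 2 (coordMeasure μ n) +
        eLpNorm (partialDeriv g n p) 2 (coordMeasure μ n)) :
    energyPart μ φ n ≤ 2 * energyPart μ f n + 2 * energyPart μ g n := by
  have hsq : ∀ a b : ℝ≥0∞, (a + b) ^ 2 ≤ 2 * (a ^ 2 + b ^ 2) := fun a b => by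
    have h1 := ENNReal.rpow_add_le_mul_rpow_add_rpow a b (p := 2) (by norm_num)
    have h2 : ((2 : ℝ≥0∞) ^ ((2 : ℝ) - 1)) = 2 := by norm_num
    rw [h2] at h1
    exact_mod_cast h1
  have hsum : ∑ p, eLpNorm (partialDeriv φ n p) 2 (coordMeasure μ n) ^ 2 ≤
      2 * (∑ p, eLpNorm (partialDeriv f n p) 2 (coordMeasure μ n) ^ 2 +
        ∑ p, eLpNorm (partialDeriv g n p) 2 (coordMeasure μ n) ^ 2) := by
    rw [← Finset.sum_add_distrib, Finset.mul_sum]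
    exact Finset.sum_le_sum fun p _ => (pow_le_pow_left' (h p) 2).trans (hsq _ _)
  unfold energyPart
  calc _ ≤ (n.factorial : ℝ≥0∞)⁻¹ * (2⁻¹ *
        (2 * (∑ p, eLpNorm (partialDeriv f n p) 2 (coordMeasure μ n) ^ 2 +
        ∑ p, eLpNorm (partialDeriv g n p) 2 (coordMeasure μ n) ^ 2))) := by gcongr
    _ = _ := by ring

theorem energyPart_sub_le (hE : IsClosedSmoothDomain E) [Nonempty E]
    (h : HasDominatedCorrelations (lebesgue E) μ ρ D) {f g : Configuration E → ℝ}
    (hf : IsSmooth f) (hg : IsSmooth g) (n : ℕ) :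
    energyPart μ (f - g) n ≤ 2 * energyPart μ f n + 2 * energyPart μ g n := by
  refine energyPart_le_of_forall_le fun p => ?_
  have hae : partialDeriv (f - g) n p =ᵐ[coordMeasure μ n]
      partialDeriv f n p - partialDeriv g n p := by
    filter_upwards [ae_coordMeasure_mem hE h n] with y hy
    exact partialDeriv_sub hf hg p hy
  rw [eLpNorm_congr_ae hae]
  exact eLpNorm_sub_le (measurable_partialDeriv f n p).aestronglyMeasurable
    (measurable_partialDeriv g n p).aestronglyMeasurable (by norm_num)

theorem energyPart_le_sub_add (hE : IsClosedSmoothDomain E) [Nonempty E]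
    (h : HasDominatedCorrelations (lebesgue E) μ ρ D) {f g : Configuration E → ℝ}
    (hf : IsSmooth f) (hg : IsSmooth g) (n : ℕ) :
    energyPart μ f n ≤ 2 * energyPart μ (f - g) n + 2 * energyPart μ g n := by
  refine energyPart_le_of_forall_le fun p => ?_
  have hae : partialDeriv f n p =ᵐ[coordMeasure μ n]
      partialDeriv (f - g) n p + partialDeriv g n p := by
    filter_upwards [ae_coordMeasure_mem hE h n] with y hy
    rw [Pi.add_apply, partialDeriv_sub hf hg p hy, sub_add_cancel]
  rw [eLpNorm_congr_ae hae]
  exact eLpNorm_add_le (measurable_partialDeriv _ n p).aestronglyMeasurable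
    (measurable_partialDeriv g n p).aestronglyMeasurable (by norm_num)

theorem sq_eLpNorm_partialDeriv_le (μ : Measure (Configuration E)) (f : Configuration E → ℝ) {n : ℕ}
    (p : Fin n × Fin d) : eLpNorm (partialDeriv f n p) 2 (coordMeasure μ n) ^ 2 ≤
      2 * n.factorial * ∑' n, energyPart μ f n := by
  have h1 : energyPart μ f n ≤ ∑' n, energyPart μ f n := ENNReal.le_tsum n
  refine le_trans ?_ (mul_le_mul_right h1 _)
  have hn0 : (n.factorial : ℝ≥0∞) ≠ 0 := by exact_mod_cast n.factorial_ne_zero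
  have hnt : (n.factorial : ℝ≥0∞) ≠ ⊤ := ENNReal.natCast_ne_top _
  have h2 : 2 * (n.factorial : ℝ≥0∞) * energyPart μ f n =
      ∑ p, eLpNorm (partialDeriv f n p) 2 (coordMeasure μ n) ^ 2 := by
    rw [energyPart]
    calc _ = ((n.factorial : ℝ≥0∞) * (n.factorial : ℝ≥0∞)⁻¹) * ((2 : ℝ≥0∞) * 2⁻¹) *
          ∑ p, eLpNorm (partialDeriv f n p) 2 (coordMeasure μ n) ^ 2 := by ring
      _ = _ := by rw [ENNReal.mul_inv_cancel hn0 hnt, ENNReal.mul_inv_cancel (by norm_num)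
                    (by norm_num), one_mul, one_mul]
  rw [h2]
  exact Finset.single_le_sum (f := fun p => eLpNorm (partialDeriv f n p) 2 (coordMeasure μ n) ^ 2)
    (fun _ _ => bot_le) (Finset.mem_univ p)

theorem sq_eLpNorm_coordFun_le (hE : IsClosed E) [Nonempty E] {f : Configuration E → ℝ}
    (hf : AEStronglyMeasurable f μ) (n : ℕ) :
    eLpNorm (coordFun f empty n) 2 (coordMeasure μ n) ^ 2 ≤ n.factorial * eLpNorm f 2 μ ^ 2 := by
  have hme := (isClosedEmbedding_coordVal hE n).measurableEmbedding
  rw [sq_eLpNorm_two, sq_eLpNorm_two, coordMeasure, hme.lintegral_map]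
  simp only [coordFun_coordVal]
  rw [lintegral_comp_ofPoints (h := fun θ => ‖f θ‖ₑ ^ 2) n (hf.enorm.pow_const 2)]
  gcongr
  exact Measure.restrict_le_self

/-- Closability of the canonical form, for fields with dominated continuous correlation
functions. -/
theorem isClosable_energy (hE : IsClosedSmoothDomain E) [Nonempty E]
    (h : HasDominatedCorrelations (lebesgue E) μ ρ D) :
    IsClosable μ (preDomain μ) (energy μ) := by
  intro u hu hu0 hcau
  have hsm : ∀ n, IsSmooth (u n) := fun n => (hu n).2.1
  have hfin : ∀ n, ∑' l, energyPart μ (u n) l ≠ ⊤ := fun n => by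
    rw [← lintegral_squareField hE h (hsm n)]
    exact (hu n).2.2.2.lintegral_lt_top.ne
  have hfin2 : ∀ p q, ∑' l, energyPart μ (u p - u q) l ≠ ⊤ := fun p q => by
    refine ne_top_of_le_ne_top ?_ (ENNReal.tsum_le_tsum fun l =>
      energyPart_sub_le hE h (hsm p) (hsm q) l)
    rw [ENNReal.tsum_add, ENNReal.tsum_mul_left, ENNReal.tsum_mul_left]
    exact ENNReal.add_ne_top.2 ⟨ENNReal.mul_ne_top (by norm_num) (hfin p),
      ENNReal.mul_ne_top (by norm_num) (hfin q)⟩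
  -- the energies as extended nonnegative numbers, free of junk values
  have hQ : Tendsto (fun p : ℕ × ℕ => ∑' l, energyPart μ (u p.1 - u p.2) l) atTop (𝓝 0) := by
    have h1 := ENNReal.tendsto_ofReal hcau
    rw [ENNReal.ofReal_zero] at h1
    refine h1.congr fun p => ?_
    rw [energy_eq hE h ((hsm p.1).sub (hsm p.2)), ENNReal.ofReal_toReal (hfin2 p.1 p.2)]
  -- on each event of a fixed number of particles, each partial derivative tends to zero
  have hpart : ∀ (n : ℕ) (i : Fin n × Fin d),
      Tendsto (fun m => eLpNorm (partialDeriv (u m) n i) 2 (coordMeasure μ n)) atTop (𝓝 0) := by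
    intro n i
    obtain ⟨s, hsmeas, hsc, hs⟩ := h.coordMeasure_eq hE n
    refine tendsto_eLpNorm_fderiv_zero (m := volume) (isOpen_interiorPoints E n) hsmeas hsc
      (v := fun m => coordFun (u m) empty n) (fun m => (hsm m).contDiffOn_interiorPoints n)
      (direction d n i) hs ?_ (fun m => ⟨(measurable_partialDeriv (u m) n i).aestronglyMeasurable,
        ?_⟩) ?_
    · refine tendsto_zero_of_sq_tendsto_zero ?_
      have h1 : Tendsto (fun m => (n.factorial : ℝ≥0∞) * eLpNorm (u m) 2 μ ^ 2) atTop (𝓝 0) := by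
        have := ENNReal.Tendsto.const_mul (a := (n.factorial : ℝ≥0∞))
          (ENNReal.Tendsto.pow (n := 2) hu0) (Or.inr (ENNReal.natCast_ne_top _))
        simpa using this
      exact tendsto_of_tendsto_of_tendsto_of_le_of_le tendsto_const_nhds h1 (fun _ => bot_le)
        fun m => sq_eLpNorm_coordFun_le hE.isClosed (hu m).2.2.1.1 n
    · have h1 := sq_eLpNorm_partialDeriv_le μ (u m) i
      have h2 : eLpNorm (partialDeriv (u m) n i) 2 (coordMeasure μ n) ^ 2 ≠ ⊤ :=
        ne_top_of_le_ne_top (ENNReal.mul_ne_top (ENNReal.mul_ne_top (by norm_num)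
          (ENNReal.natCast_ne_top _)) (hfin m)) h1
      exact lt_top_iff_ne_top.2 fun htop => h2 (by
        rw [show eLpNorm (partialDeriv (u m) n i) 2 (coordMeasure μ n) = ⊤ from htop]; simp)
    · refine tendsto_zero_of_sq_tendsto_zero ?_
      have h1 : Tendsto (fun p : ℕ × ℕ => 2 * (n.factorial : ℝ≥0∞) *
          ∑' l, energyPart μ (u p.1 - u p.2) l) atTop (𝓝 0) := by
        have := ENNReal.Tendsto.const_mul (a := 2 * (n.factorial : ℝ≥0∞)) hQ
          (Or.inr (ENNReal.mul_ne_top (by norm_num) (ENNReal.natCast_ne_top _)))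
        rwa [mul_zero] at this
      refine tendsto_of_tendsto_of_tendsto_of_le_of_le tendsto_const_nhds h1 (fun _ => bot_le)
        fun p => ?_
      refine le_trans (le_of_eq ?_) (sq_eLpNorm_partialDeriv_le μ (u p.1 - u p.2) i)
      congr 1
      refine eLpNorm_congr_ae ?_
      filter_upwards [ae_coordMeasure_mem hE h n] with y hy
      exact (partialDeriv_sub (hsm p.1) (hsm p.2) i hy).symm
  have hpart' : ∀ n, Tendsto (fun m => energyPart μ (u m) n) atTop (𝓝 0) := by
    intro n
    have h1 : Tendsto (fun m => ∑ i, eLpNorm (partialDeriv (u m) n i) 2 (coordMeasure μ n) ^ 2)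
        atTop (𝓝 0) := by
      have := tendsto_finsetSum (Finset.univ : Finset (Fin n × Fin d)) fun i _ =>
        ENNReal.Tendsto.pow (n := 2) (hpart n i)
      simpa using this
    have h2 := ENNReal.Tendsto.const_mul (a := (n.factorial : ℝ≥0∞)⁻¹)
      (ENNReal.Tendsto.const_mul (a := (2 : ℝ≥0∞)⁻¹) h1 (Or.inr (by norm_num)))
      (Or.inr (ENNReal.inv_ne_top.2 (by exact_mod_cast n.factorial_ne_zero)))
    simpa [energyPart] using h2
  -- finite sums of the parts of `u m` are bounded by `ε`, uniformly in `m`, by comparison with `u q`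
  -- for `q → ∞`
  have hQ0 : Tendsto (fun m => ∑' n, energyPart μ (u m) n) atTop (𝓝 0) := by
    rw [ENNReal.tendsto_atTop_zero]
    intro ε hε
    have hε2 : 0 < ε / 2 := ENNReal.half_pos hε.ne'
    obtain ⟨⟨P, P'⟩, hP⟩ := eventually_atTop.1 (hQ.eventually_le_const hε2)
    refine ⟨max P P', fun m hm => ?_⟩
    rw [ENNReal.tsum_eq_iSup_sum]
    refine iSup_le fun F => ?_
    have h1 : Tendsto (fun q => 2 * (ε / 2) + 2 * ∑ n ∈ F, energyPart μ (u q) n) atTop (𝓝 ε) := by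
      have h2 : Tendsto (fun q => ∑ n ∈ F, energyPart μ (u q) n) atTop (𝓝 0) := by
        simpa using tendsto_finsetSum F fun n _ => hpart' n
      have h3 := (ENNReal.Tendsto.const_mul (a := 2) h2 (Or.inr (by norm_num))).const_add
        (2 * (ε / 2))
      have h4 : 2 * (ε / 2) = ε := ENNReal.mul_div_cancel (by norm_num) (by norm_num)
      simpa only [mul_zero, add_zero, h4] using h3
    refine ge_of_tendsto h1 ?_
    filter_upwards [eventually_ge_atTop (max P P')] with q hq
    calc ∑ n ∈ F, energyPart μ (u m) n
        ≤ ∑ n ∈ F, (2 * energyPart μ (u m - u q) n + 2 * energyPart μ (u q) n) :=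
          Finset.sum_le_sum fun n _ => energyPart_le_sub_add hE h (hsm m) (hsm q) n
      _ = 2 * ∑ n ∈ F, energyPart μ (u m - u q) n + 2 * ∑ n ∈ F, energyPart μ (u q) n := by
          rw [Finset.sum_add_distrib, Finset.mul_sum, Finset.mul_sum]
      _ ≤ 2 * (ε / 2) + 2 * ∑ n ∈ F, energyPart μ (u q) n := by
          gcongr
          exact (ENNReal.sum_le_tsum F).trans
            (hP (m, q) ⟨(le_max_left _ _).trans hm, (le_max_right _ _).trans hq⟩)
  have h1 := (ENNReal.tendsto_toReal ENNReal.zero_ne_top).comp hQ0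
  refine h1.congr fun m => ?_
  rw [energy_eq hE h (hsm m)]
  rfl

end Energy

/-- Determinantal fields of trace class have dominated correlation functions, by Hadamard's
inequality. -/
theorem IsDeterminantal.exists_hasDominatedCorrelations {d : ℕ}
    {E : Set (EuclideanSpace ℝ (Fin d))} (hE : IsClosedSmoothDomain E)
    {K : Lp ℂ 2 (lebesgue E) →L[ℂ] Lp ℂ 2 (lebesgue E)} (hpos : K.IsPositive)
    {k : E → E → ℂ} (hk : Continuous fun p : E × E => k p.1 p.2)
    (hKk : HasKernel (lebesgue E) K k) {μ : Measure (Configuration E)}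
    (hμ : IsDeterminantal (lebesgue E) μ k) (htr : IsTraceClass K) :
    ∃ ρ : (n : ℕ) → (Fin n → E) → ℝ,
      HasDominatedCorrelations (lebesgue E) μ ρ fun x => (k x x).re := by
  have := ProperSpace.of_isClosed hE.isClosed
  have := isFiniteMeasureOnCompacts_lebesgue hE.isClosed
  have := isOpenPosMeasure_lebesgue hE
  obtain ⟨ρ, hρ, hdet⟩ := hμ
  have hre : ∀ n x, ρ n x = (Matrix.of fun i j => k (x i) (x j)).det.re := fun n x => by
    rw [← hdet, Complex.ofReal_re]
  have hdiag : Continuous fun x => (k x x).re :=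
    Complex.continuous_re.comp (hk.comp (continuous_id.prodMk continuous_id))
  have hnn : ∀ x, 0 ≤ (k x x).re := fun x => by
    have h1 := (hρ 1).nonneg fun _ => x
    rw [hre] at h1
    simpa using h1
  refine ⟨ρ, hρ, fun n => ?_, hnn, hdiag, ⟨hdiag.aestronglyMeasurable, ?_⟩, fun n x => ?_⟩
  · rw [show ρ n = fun x => (Matrix.of fun i j => k (x i) (x j)).det.re from funext (hre n)]
    refine Complex.continuous_re.comp (Continuous.matrix_det (continuous_matrix fun i j => ?_))
    exact hk.comp (by fun_prop : Continuous fun x : Fin n → E => (x i, x j))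
  · rw [hasFiniteIntegral_iff_ofReal (ae_of_all _ hnn)]
    exact lintegral_diag_lt_top hE hpos hk hKk htr
  · rw [hre]
    exact (hKk.posSemidef hk hpos x).re_det_le_prod_diag

end PointField

end

theorem proposition2p9 (d : ℕ) (E : Set (EuclideanSpace ℝ (Fin d))) (hE : IsClosedSmoothDomain E)
    (K : Lp ℂ 2 (lebesgue E) →L[ℂ] Lp ℂ 2 (lebesgue E)) (hpos : K.IsPositive)
    (k : E → E → ℂ) (hk : Continuous fun p : E × E => k p.1 p.2)
    (hKk : HasKernel (lebesgue E) K k)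
    (μ : Measure (Configuration E)) [IsProbabilityMeasure μ]
    (hμ : IsDeterminantal (lebesgue E) μ k) (htr : IsTraceClass K) :
    IsClosable μ (preDomain μ) (energy μ) := by
  obtain ⟨ρ, hρ⟩ := hμ.exists_hasDominatedCorrelations hE hpos hk hKk htr
  have : Nonempty E := by
    obtain ⟨U, -, hU, -, rfl⟩ := hE
    exact hU.nonempty.closure.to_subtype
  exact isClosable_energy hE hρ
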